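/- For a division ring $D\in\{\mathbb R,\mathbb C,\mathbb H\}$, let $\mathfrak{gl}(n,D)$ be the $n\times n$ matrices over $D$ and $\mathrm{GL}(n,D)$ the invertible ones. Call $X\in\mathfrak{gl}(n,D)$ *$\mathrm{Ad}_{\mathrm{GL}(n,D)}$-real* if $gXg^{-1}=-X$ for some $g\in \mathrm{GL}(n,D)$. Let $J(\lambda,m)$ ($m\ge 1$) be the $m\times m$ matrix with $\lambda$ on the diagonal, $1$ on the superdiagonal and $0$ elsewhere. For $\mu,\nu\in\mathbb R$ let $J_{\mathbb R}(\mu\pm i\nu,2\ell)$ be the real $2\ell\times 2\ell$ matrix obtained from $J(\mu+i\nu,\ell)$ by replacing each complex entry $z$ by $\begin{pmatrix}\operatorname{Re}z&\operatorname{Im}z\\-\operatorname{Im}z&\operatorname{Re}z\end{pmatrix}$. A *Jordan form* of $X$ is a matrix $SXS^{-1}$, $S\in\mathrm{GL}(n,D)$, that is a direct sum of blocks of the following kinds: for $D=\mathbb C$, $J(\lambda,m)$ with $\lambda\in\mathbb C$; for $D=\mathbb R$, $J(\lambda,m)$ with $\lambda\in\mathbb R$ and $J_{\mathbb R}(\mu\pm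 i\nu,2\ell)$ with $\mu,\nu\in\mathbb R$, $\nu>0$; for $D=\mathbb H$, $J(\lambda,m)$ with $\lambda\in\mathbb C$, $\operatorname{Im}\lambda\ge 0$. **Theorem.** Let $D=\mathbb R,\mathbb C$ or $\mathbb H$, $n\ge 0$ and $X\in\mathfrak{gl}(n,D)$. Then $X$ has a Jordan form, and for every Jordan form of $X$, $X$ is $\mathrm{Ad}_{\mathrm{GL}(n,D)}$-real if and only if the blocks of the form (counted with multiplicity) can be partitioned into pairs and singletons as follows. 1. For $D=\mathbb R$: pairs $\{J_{\mathbb R}(\mu\pm i\nu,2t),\,J_{\mathbb R}(-\mu\pm i\nu,2t)\}$ with $\mu\ne0$, $\nu>0$, pairs $\{J(\lambda,s),J(-\lambda,s)\}$ with $\lambda\in\mathbb R$, $\lambda\neq 0$, singletons $\{J_{\mathbb R}(0\pm i\nu,2\ell)\}$ with $\nu>0$, and singletons $\{J(0,m)\}$. 2. For $D=\mathbb C$: pairs $\{J(\lambda,s),J(-\lambda,s)\}$ with $\lambda\in\mathbb C$, $\lambda\ne0$, and singletons $\{J(0,m)\}$. 3. For $D=\mathbb H$: pairs $\{J(\lambda,s),J(-\overline{\lambda},s)\}$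 with $\lambda\in\mathbb C$, $\operatorname{Im}\lambda\ge0$, $\operatorname{Re}\lambda\ne0$, and singletons $\{J(\mu,m)\}$ with $\mu\in\mathbb C$, $\operatorname{Im}\mu\ge0$, $\operatorname{Re}\mu=0$. (Here $-\overline\lambda$ is the unique complex number with non-negative imaginary part that is similar to $-\lambda$ in $\mathbb H$, so $J(-\overline\lambda,s)$ is conjugate to $J(-\lambda,s)$.) -/

import Mathlib

open scoped Quaternion

namespace AdjointReality

/-- The Jordan block `J(a, m)`: `a` on the diagonal, `1` on the super-diagonal, `0` elsewhere. -/
def jordanBlock {D : Type*} [Zero D] [One D] (a : D) (m : ℕ) : Matrix (Fin m) (Fin m) D :=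
  Matrix.of fun i j => if i = j then a else if (i : ℕ) + 1 = (j : ℕ) then 1 else 0

/-- The embedding `ψ` of `ℂ` into the real `2 × 2` matrices. -/
def psi (z : ℂ) : Matrix (Fin 2) (Fin 2) ℝ :=
  !![z.re, z.im; -z.im, z.re]

/-- The embedding `Ψ` of complex `m × m` matrices into real `2m × 2m` matrices, which replaces
every entry `z` by the `2 × 2` block `ψ z`. (The `(i, a)` row has number `2 i + a`.) -/
def Psi {m : ℕ} (A : Matrix (Fin m) (Fin m) ℂ) : Matrix (Fin (m * 2)) (Fin (m * 2)) ℝ :=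
  Matrix.reindex finProdFinEquiv finProdFinEquiv
    (Matrix.of fun (p q : Fin m × Fin 2) => psi (A p.1 q.1) p.2 q.2)

/-- `J_ℝ(μ ± iν, 2ℓ) = Ψ(J(μ + iν, ℓ))`, with `z = μ + iν`.
The matrix `J_ℝ(μ ∓ iν, 2ℓ)` is `realJordanBlock` at `z = μ - iν`. -/
def realJordanBlock (z : ℂ) (l : ℕ) : Matrix (Fin (l * 2)) (Fin (l * 2)) ℝ :=
  Psi (jordanBlock z l)

/-- `X ∈ gl(n, D)` is `Ad_{GL(n, D)}`-real: `g X g⁻¹ = -X` for some `g ∈ GL(n, D)`. -/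
def IsAdReal {D : Type*} [Ring D] {n : ℕ} (X : Matrix (Fin n) (Fin n) D) : Prop :=
  ∃ g : (Matrix (Fin n) (Fin n) D)ˣ,
    (g : Matrix (Fin n) (Fin n) D) * X * ((g⁻¹ : (Matrix (Fin n) (Fin n) D)ˣ) :
      Matrix (Fin n) (Fin n) D) = -X

/-- `S X S⁻¹ = B₁ ⊕ ⋯ ⊕ B_k` for some `S ∈ GL(n, D)`, where `B i` is a square matrix of size
`size i` and the sizes add up to `n`. -/
def IsConjToDirectSum {D : Type*} [Ring D] {n k : ℕ} (X : Matrix (Fin n) (Fin n) D)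
    (size : Fin k → ℕ) (B : (i : Fin k) → Matrix (Fin (size i)) (Fin (size i)) D) : Prop :=
  ∃ (h : ∑ i, size i = n) (S : (Matrix (Fin n) (Fin n) D)ˣ),
    (S : Matrix (Fin n) (Fin n) D) * X * ((S⁻¹ : (Matrix (Fin n) (Fin n) D)ˣ) :
      Matrix (Fin n) (Fin n) D) =
    Matrix.reindex (finSigmaFinEquiv.trans (finCongr h)) (finSigmaFinEquiv.trans (finCongr h))
      (Matrix.blockDiagonal' B)

/-- The members of the family `b` can be partitioned into pairs `{b i, b j}`, `i ≠ j`, satisfying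
`pair`, and singletons `{b i}` satisfying `single`. -/
def CanBePartitioned {β : Type*} {k : ℕ} (b : Fin k → β) (pair : β → β → Prop)
    (single : β → Prop) : Prop :=
  ∃ P : Finpartition (Finset.univ : Finset (Fin k)), ∀ p ∈ P.parts,
    (∃ i j, i ≠ j ∧ p = {i, j} ∧ pair (b i) (b j)) ∨ (∃ i, p = {i} ∧ single (b i))

/-! ### Blocks of real Jordan forms -/

/-- A block of a Jordan form over `ℝ`: either `J(lam, m)`, or `J_ℝ(mu ± i nu, 2l)` with
`nu > 0`. -/
inductive RealBlock : Type
  | ofReal (lam : ℝ) (m : ℕ) (hm : 0 < m) : RealBlock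
  | ofComplex (mu nu : ℝ) (l : ℕ) (hnu : 0 < nu) (hl : 0 < l) : RealBlock

def RealBlock.size : RealBlock → ℕ
  | .ofReal _ m _ => m
  | .ofComplex _ _ l _ _ => l * 2

def RealBlock.toMatrix : (b : RealBlock) → Matrix (Fin b.size) (Fin b.size) ℝ
  | .ofReal lam m _ => jordanBlock lam m
  | .ofComplex mu nu l _ _ => realJordanBlock ⟨mu, nu⟩ l

/-- The pairs `{J(λ, s), J(-λ, s)}` with `λ ≠ 0`, and
`{J_ℝ(μ ± iν, 2t), J_ℝ(-μ ∓ iν, 2t)}` with `μ ≠ 0`. Blocks of a Jordan form are normalized to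
`ν > 0`, so the second block of the latter pair occurs as `J_ℝ(-μ ± iν, 2t)`, to which
`J_ℝ(-μ ∓ iν, 2t)` is conjugate (`isConj_realJordanBlock`). -/
def RealBlock.IsPair : RealBlock → RealBlock → Prop
  | .ofReal lam m _, .ofReal lam' m' _ => lam ≠ 0 ∧ lam' = -lam ∧ m' = m
  | .ofComplex mu nu l _ _, .ofComplex mu' nu' l' _ _ =>
      mu ≠ 0 ∧ mu' = -mu ∧ nu' = nu ∧ l' = l
  | _, _ => False

/-- The singletons `J(0, m)` and `J_ℝ(0 ± iν, 2ℓ)`. -/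
def RealBlock.IsSingleton : RealBlock → Prop
  | .ofReal lam _ _ => lam = 0
  | .ofComplex mu _ _ _ _ => mu = 0

/-- `b` lists the blocks of a Jordan form of `X`. -/
def IsRealJordanForm {n k : ℕ} (X : Matrix (Fin n) (Fin n) ℝ) (b : Fin k → RealBlock) : Prop :=
  IsConjToDirectSum X (fun i => (b i).size) (fun i => (b i).toMatrix)

/-! ### Blocks of complex Jordan forms -/

/-- A block `J(lam, m)` of a Jordan form over `ℂ`. -/
structure ComplexBlock : Type where
  lam : ℂ
  m : ℕ
  hm : 0 < m

/-- The pairs `{J(λ, s), J(-λ, s)}` with `λ ≠ 0`. -/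
def ComplexBlock.IsPair (b b' : ComplexBlock) : Prop :=
  b.lam ≠ 0 ∧ b'.lam = -b.lam ∧ b'.m = b.m

/-- The singletons `J(0, m)`. -/
def ComplexBlock.IsSingleton (b : ComplexBlock) : Prop :=
  b.lam = 0

/-- `b` lists the blocks of a Jordan form of `X`. -/
def IsComplexJordanForm {n k : ℕ} (X : Matrix (Fin n) (Fin n) ℂ) (b : Fin k → ComplexBlock) :
    Prop :=
  IsConjToDirectSum X (fun i => (b i).m) (fun i => jordanBlock (b i).lam (b i).m)

/-! ### Blocks of quaternionic Jordan forms -/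

/-- A block `J(lam, m)` of a Jordan form over `ℍ`, where `lam` is the complex representative with
non-negative imaginary part of a similarity class of eigenvalues. -/
structure QuaternionBlock : Type where
  lam : ℂ
  m : ℕ
  hlam : 0 ≤ lam.im
  hm : 0 < m

/-- The pairs `{J(λ, s), J(-λ, s)}` with `Re λ ≠ 0`. Here `-λ` stands for its similarity class in
`ℍ`, whose complex representative with non-negative imaginary part is the negative of the
complex conjugate of `λ` (`isConj_quaternionJordanBlock`). -/
def QuaternionBlock.IsPair (b b' : QuaternionBlock) : Prop :=
  b.lam.re ≠ 0 ∧ b'.lam = -(starRingEnd ℂ b.lam) ∧ b'.m = b.m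

/-- The singletons `J(μ, m)` with `Re μ = 0`. -/
def QuaternionBlock.IsSingleton (b : QuaternionBlock) : Prop :=
  b.lam.re = 0

/-- `b` lists the blocks of a Jordan form of `X`. -/
def IsQuaternionJordanForm {n k : ℕ} (X : Matrix (Fin n) (Fin n) ℍ[ℝ])
    (b : Fin k → QuaternionBlock) : Prop :=
  IsConjToDirectSum X (fun i => (b i).m) (fun i => jordanBlock ((b i).lam : ℍ[ℝ]) (b i).m)

/-! ### The normalized second blocks of pairs are conjugate to the blocks they stand for -/

/-- `J_ℝ(-μ ∓ iν, 2t)` and `J_ℝ(-μ ± iν, 2t)` are conjugate. -/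
theorem isConj_realJordanBlock (mu nu : ℝ) (t : ℕ) :
    IsConj (realJordanBlock ⟨-mu, -nu⟩ t) (realJordanBlock ⟨-mu, nu⟩ t) := by
  set d : Matrix (Fin (t * 2)) (Fin (t * 2)) ℝ :=
    Matrix.reindex finProdFinEquiv finProdFinEquiv
      (Matrix.diagonal fun p : Fin t × Fin 2 => if p.2 = 0 then (1 : ℝ) else -1) with hd
  have hdd : d * d = 1 := by
    simp only [hd, Matrix.reindex_apply, Matrix.submatrix_mul_equiv, Matrix.diagonal_mul_diagonal]
    have : (fun p : Fin t × Fin 2 => (if p.2 = 0 then (1 : ℝ) else -1) *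
        (if p.2 = 0 then (1 : ℝ) else -1)) = fun _ => 1 := by
      funext p
      split_ifs <;> norm_num
    rw [this, Matrix.diagonal_one, Matrix.submatrix_one_equiv]
  refine ⟨⟨d, d, hdd, hdd⟩, ?_⟩
  change d * _ = _ * d
  simp only [hd, realJordanBlock, Psi, Matrix.reindex_apply, Matrix.submatrix_mul_equiv]
  congr 1
  ext ⟨i, a⟩ ⟨j, c⟩
  rw [Matrix.diagonal_mul, Matrix.mul_diagonal]
  fin_cases a <;> fin_cases c <;> simp [psi, jordanBlock] <;> split_ifs <;> simp

/-- Over `ℍ`, the block `J(-λ, s)` is conjugate to `J(-conj λ, s)`. -/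
theorem isConj_quaternionJordanBlock (z : ℂ) (s : ℕ) :
    IsConj (jordanBlock (((-z : ℂ)) : ℍ[ℝ]) s)
      (jordanBlock ((-(starRingEnd ℂ z) : ℂ) : ℍ[ℝ]) s) := by
  obtain ⟨q, hr, hi, hj, hk⟩ : ∃ q : ℍ[ℝ], q.re = 0 ∧ q.imI = 0 ∧ q.imJ = 1 ∧ q.imK = 0 :=
    ⟨⟨0, 0, 1, 0⟩, rfl, rfl, rfl, rfl⟩
  have h1 : q * -q = 1 := by ext <;> simp [hr, hi, hj, hk]
  have h2 : -q * q = 1 := by ext <;> simp [hr, hi, hj, hk]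
  have h3 : q * ((-z : ℂ) : ℍ[ℝ]) = ((-(starRingEnd ℂ z) : ℂ) : ℍ[ℝ]) * q := by
    ext <;> simp [hr, hi, hj, hk]
  refine ⟨⟨Matrix.diagonal fun _ => q, Matrix.diagonal fun _ => -q, ?_, ?_⟩, ?_⟩
  · simp only [Matrix.diagonal_mul_diagonal, h1, Matrix.diagonal_one]
  · simp only [Matrix.diagonal_mul_diagonal, h2, Matrix.diagonal_one]
  · change Matrix.diagonal (fun _ => q) * _ = _ * Matrix.diagonal (fun _ => q)
    ext1 i j
    rw [Matrix.diagonal_mul, Matrix.mul_diagonal]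
    simp only [jordanBlock, Matrix.of_apply]
    split_ifs
    · exact h3
    · simp
    · simp

end AdjointReality

/-! Embed `D` into complex `d × d` matrices (`d = 1, 1, 2` for `ℂ`, `ℝ`, `ℍ`) and complexify. Over
`ℂ` a matrix is determined up to similarity by its numbers of Jordan blocks, and the number of
blocks of size `m + 1` at `z` is a second difference of the ranks of `(M - z) ^ t`
(`similar_of_blockCount_eq`). No similarity is gained by complexifying: if `P + iQ` intertwines two
matrices over `D`, so do `P` and `Q`, and `P + tQ` is invertible for some real `t`
(`IsComplexification.similar_of_complexify`).

Every block `x` over `D` has a complex Jordan type, its `key`, that occurs in `x` and in no other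
block. Hence the multiplicity of `x` in a direct sum is the count at `key x` divided by the count in
`x` itself. Passing from `X` to `-X` permutes the blocks by an involution `σ`, so `X` is similar to
`-X` exactly when multiplicities are `σ`-invariant. This holds exactly when the blocks split into
pairs `{x, σ x}` with `σ x ≠ x` and fixed singletons.

A Jordan form exists because the same quotients define a direct sum with the right complexification,
which descends to `D`. The quotients must be integers; the one delicate case is a real eigenvalue
over `ℍ`, where a block contributes two equal complex blocks. There the ranks are even, by comparing
real dimensions of row spaces (`even_rank_complexify_quaternionToMatrix`). -/

namespace AdjointReality

open Matrix

/-! ### Similarity of square matrices with possibly different index types -/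

section Similar

variable {R : Type*} [Ring R] {ι κ τ : Type*} [Fintype ι] [DecidableEq ι] [Fintype κ]
  [DecidableEq κ] [Fintype τ] [DecidableEq τ]

/-- Similarity of square matrices, by means of a rectangular matrix with a two-sided inverse. -/
def Similar (M : Matrix ι ι R) (N : Matrix κ κ R) : Prop :=
  ∃ (P : Matrix ι κ R) (Q : Matrix κ ι R), P * Q = 1 ∧ Q * P = 1 ∧ M * P = P * N

theorem Similar.symm {M : Matrix ι ι R} {N : Matrix κ κ R} (h : Similar M N) : Similar N M := by
  obtain ⟨P, Q, h1, h2, h3⟩ := h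
  refine ⟨Q, P, h2, h1, ?_⟩
  calc N * Q = Q * P * N * Q := by rw [h2, Matrix.one_mul]
    _ = Q * (P * N) * Q := by simp only [Matrix.mul_assoc]
    _ = Q * M * (P * Q) := by rw [← h3]; simp only [Matrix.mul_assoc]
    _ = Q * M := by rw [h1, Matrix.mul_one]

theorem Similar.trans {M : Matrix ι ι R} {N : Matrix κ κ R} {L : Matrix τ τ R}
    (h : Similar M N) (h' : Similar N L) : Similar M L := by
  obtain ⟨P, Q, h1, h2, h3⟩ := h
  obtain ⟨P', Q', h1', h2', h3'⟩ := h'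
  refine ⟨P * P', Q' * Q, ?_, ?_, ?_⟩
  · rw [Matrix.mul_assoc, ← Matrix.mul_assoc P', h1', Matrix.one_mul, h1]
  · rw [Matrix.mul_assoc, ← Matrix.mul_assoc Q, h2, Matrix.one_mul, h2']
  · rw [← Matrix.mul_assoc, h3, Matrix.mul_assoc, h3', Matrix.mul_assoc]

theorem similar_submatrix (M : Matrix κ κ R) (e : ι ≃ κ) : Similar (M.submatrix e e) M := by
  refine ⟨(1 : Matrix κ κ R).submatrix e id, (1 : Matrix κ κ R).submatrix id e, ?_, ?_, ?_⟩
  · ext i j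
    simp [Matrix.mul_apply, Matrix.one_apply]
  · ext i j
    simp [Matrix.mul_apply, Matrix.one_apply, ← e.eq_symm_apply]
  · rw [submatrix_mul_equiv, Matrix.mul_one]
    ext i j
    simp [Matrix.mul_apply, Matrix.one_apply]

theorem similar_of_units {M N : Matrix ι ι R} (S : (Matrix ι ι R)ˣ)
    (h : (S : Matrix ι ι R) * M * ((S⁻¹ : (Matrix ι ι R)ˣ) : Matrix ι ι R) = N) :
    Similar N M :=
  ⟨S, ((S⁻¹ : (Matrix ι ι R)ˣ) : Matrix ι ι R), S.mul_inv, S.inv_mul, by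
    rw [← h, Matrix.mul_assoc, S.inv_mul, Matrix.mul_one]⟩

theorem Similar.exists_units {M N : Matrix ι ι R} (h : Similar N M) :
    ∃ S : (Matrix ι ι R)ˣ,
      (S : Matrix ι ι R) * M * ((S⁻¹ : (Matrix ι ι R)ˣ) : Matrix ι ι R) = N := by
  obtain ⟨P, Q, h1, h2, h3⟩ := h
  refine ⟨⟨P, Q, h1, h2⟩, ?_⟩
  change P * M * Q = N
  rw [← h3, Matrix.mul_assoc, h1, Matrix.mul_one]

/-- Since `Similar` permits different index types, equality of sizes is a consequence. It later
forces the sizes of the blocks read off from ranks to add up to `n`. -/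
theorem Similar.card_eq {K : Type*} [Field K] {M : Matrix ι ι K} {N : Matrix κ κ K}
    (h : Similar M N) : Fintype.card ι = Fintype.card κ := by
  obtain ⟨P, Q, h1, h2, -⟩ := h
  apply le_antisymm
  · calc Fintype.card ι = (P * Q).rank := by rw [h1, rank_one]
      _ ≤ P.rank := rank_mul_le_left _ _
      _ ≤ Fintype.card κ := rank_le_card_width _
  · calc Fintype.card κ = (Q * P).rank := by rw [h2, rank_one]
      _ ≤ Q.rank := rank_mul_le_left _ _
      _ ≤ Fintype.card ι := rank_le_card_width _

end Similar

/-! ### Ranks of the powers of `M - z` -/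

section Rank

variable {ι κ : Type*} [Fintype ι] [DecidableEq ι] [Fintype κ] [DecidableEq κ]

/-- The rank of `(M - z) ^ m`. -/
noncomputable def rankPow (M : Matrix ι ι ℂ) (z : ℂ) (m : ℕ) : ℕ := ((M - z • 1) ^ m).rank

theorem Similar.rankPow_le {M : Matrix ι ι ℂ} {N : Matrix κ κ ℂ} (h : Similar M N) (z : ℂ)
    (m : ℕ) : rankPow M z m ≤ rankPow N z m := by
  obtain ⟨P, Q, h1, h2, h3⟩ := h
  have hpow : (M - z • 1) ^ m * P = P * (N - z • 1) ^ m := by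
    induction m with
    | zero => simp
    | succ m ih =>
      have h4 : (M - z • 1) * P = P * (N - z • 1) := by
        simp [Matrix.mul_sub, Matrix.sub_mul, h3]
      rw [pow_succ, Matrix.mul_assoc, h4, pow_succ, ← Matrix.mul_assoc, ih, Matrix.mul_assoc]
  have : (M - z • 1) ^ m = P * (N - z • 1) ^ m * Q := by
    rw [← hpow, Matrix.mul_assoc, h1, Matrix.mul_one]
  unfold rankPow
  rw [this]
  exact (rank_mul_le_left _ _).trans (rank_mul_le_right _ _)

theorem Similar.rankPow_eq {M : Matrix ι ι ℂ} {N : Matrix κ κ ℂ} (h : Similar M N) (z : ℂ)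
    (m : ℕ) : rankPow M z m = rankPow N z m :=
  le_antisymm (h.rankPow_le z m) (h.symm.rankPow_le z m)

theorem exists_mul_mul_eq_diagonal {K : Type*} [Field K] (M : Matrix ι ι K) :
    ∃ (V U : Matrix ι ι K) (w : ι → K), IsUnit V ∧ IsUnit U ∧ V * M * U = diagonal w := by
  obtain ⟨V, U, e, hV, hU, h⟩ := exists_rank_normal_form M
  refine ⟨V, U, fun i => Sum.elim (fun _ => 1) (fun _ => 0) (e i), hV, hU, ?_⟩
  rw [h, ← diagonal_one, ← diagonal_zero, fromBlocks_diagonal, submatrix_diagonal_equiv]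
  rfl

theorem rank_mul_mul_eq {K : Type*} [Field K] {V M U : Matrix ι ι K} (hV : IsUnit V)
    (hU : IsUnit U) : (V * M * U).rank = M.rank := by
  rw [rank_mul_eq_left_of_isUnit_det _ _ ((isUnit_iff_isUnit_det _).1 hU),
    rank_mul_eq_right_of_isUnit_det _ _ ((isUnit_iff_isUnit_det _).1 hV)]

/-- Invertible row and column operations make each block diagonal and assemble to invertible block
diagonal matrices; the rank of a diagonal matrix counts its nonzero entries. -/
theorem rank_blockDiagonal' {K : Type*} [Field K] {o : Type*} [Fintype o] [DecidableEq o]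
    {m : o → Type*} [∀ i, Fintype (m i)] [∀ i, DecidableEq (m i)]
    (B : ∀ i, Matrix (m i) (m i) K) : (blockDiagonal' B).rank = ∑ i, (B i).rank := by
  classical
  choose V U w hV hU h using fun i => exists_mul_mul_eq_diagonal (B i)
  have hVb : IsUnit (blockDiagonal' V) :=
    (Pi.isUnit_iff.2 hV).map (blockDiagonal'RingHom m K)
  have hUb : IsUnit (blockDiagonal' U) :=
    (Pi.isUnit_iff.2 hU).map (blockDiagonal'RingHom m K)
  have hB : blockDiagonal' V * blockDiagonal' B * blockDiagonal' U =
      diagonal fun p : Σ i, m i => w p.1 p.2 := by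
    rw [← blockDiagonal'_mul, ← blockDiagonal'_mul, ← blockDiagonal'_diagonal]
    congr 1
    funext i
    exact h i
  rw [← rank_mul_mul_eq hVb hUb, hB, rank_diagonal]
  have : ∀ i, (B i).rank = Fintype.card {j // w i j ≠ 0} := fun i => by
    rw [← rank_mul_mul_eq (hV i) (hU i), h i, rank_diagonal]
  simp only [this, Fintype.card_subtype]
  rw [← Finset.card_sigma]
  congr 1
  ext ⟨i, j⟩
  simp

theorem rankPow_blockDiagonal' {o : Type*} [Fintype o] [DecidableEq o]
    {m : o → Type*} [∀ i, Fintype (m i)] [∀ i, DecidableEq (m i)]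
    (B : ∀ i, Matrix (m i) (m i) ℂ) (z : ℂ) (t : ℕ) :
    rankPow (blockDiagonal' B) z t = ∑ i, rankPow (B i) z t := by
  unfold rankPow
  rw [← rank_blockDiagonal', ← blockDiagonal'_one, ← blockDiagonal'_smul, ← blockDiagonal'_sub,
    ← blockDiagonal'_pow]
  rfl

theorem jordanBlock_sub_smul_one (a z : ℂ) (k : ℕ) :
    jordanBlock a k - z • (1 : Matrix (Fin k) (Fin k) ℂ) = jordanBlock (a - z) k := by
  ext i j
  simp only [jordanBlock, Matrix.sub_apply, Matrix.smul_apply, of_apply, Matrix.one_apply]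
  split_ifs <;> simp

theorem jordanBlock_zero_pow (k t : ℕ) :
    (jordanBlock (0 : ℂ) k) ^ t = of fun i j : Fin k => if (i : ℕ) + t = j then 1 else 0 := by
  induction t with
  | zero =>
    ext i j
    simp [Matrix.one_apply, Fin.ext_iff]
  | succ t ih =>
    rw [pow_succ, ih]
    ext i j
    simp only [Matrix.mul_apply, of_apply, jordanBlock, ite_mul, one_mul, zero_mul]
    by_cases h : (i : ℕ) + (t + 1) = j
    · rw [if_pos h, Finset.sum_eq_single ⟨i + t, by omega⟩]
      · simp only [if_true, Fin.ext_iff]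
        rw [if_neg (by omega), if_pos (by omega)]
      · intro b _ hb
        rw [if_neg]
        intro h'
        exact hb (Fin.ext h'.symm)
      · simp
    · rw [if_neg h]
      refine Finset.sum_eq_zero fun b _ => ?_
      by_cases h1 : (i : ℕ) + t = b
      · rw [if_pos h1]
        split_ifs with h2 h3
        · rfl
        · omega
        · rfl
      · rw [if_neg h1]

/-- `S * Sᵀ` is the diagonal projection `D` onto the rows with `i + t < k`, and `D * S = S`, so each
rank bounds the other. -/
theorem rank_shift (k t : ℕ) :
    (of fun i j : Fin k => if (i : ℕ) + t = j then (1 : ℂ) else 0).rank = k - t := by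
  set S : Matrix (Fin k) (Fin k) ℂ := of fun i j : Fin k => if (i : ℕ) + t = j then (1 : ℂ) else 0
    with hS
  set D : Matrix (Fin k) (Fin k) ℂ :=
    diagonal fun i : Fin k => if (i : ℕ) + t < k then (1 : ℂ) else 0 with hD
  have h1 : S * Sᵀ = D := by
    ext i j
    simp only [hS, hD, Matrix.mul_apply, of_apply, transpose_apply, diagonal_apply, ite_mul,
      one_mul, zero_mul]
    by_cases h : (i : ℕ) + t < k
    · rw [Finset.sum_eq_single ⟨i + t, h⟩]
      · simp [h, Fin.ext_iff, eq_comm]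
      · intro b _ hb
        rw [if_neg]
        intro h'
        exact hb (Fin.ext h'.symm)
      · simp
    · rw [Finset.sum_eq_zero]
      · simp [h]
      · intro b _
        rw [if_neg]
        omega
  have h2 : D * S = S := by
    ext i j
    simp only [hS, hD, diagonal_mul, of_apply]
    have := j.2
    split_ifs <;> first | omega | simp
  have h3 : S.rank = D.rank :=
    le_antisymm (h2 ▸ rank_mul_le_left D S) (h1 ▸ rank_mul_le_left S Sᵀ)
  rw [h3, hD, rank_diagonal, Fintype.card_subtype]
  have : (Finset.univ.filter fun i : Fin k => (if (i : ℕ) + t < k then (1 : ℂ) else 0) ≠ 0) =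
      Finset.univ.filter fun i : Fin k => (i : ℕ) < k - t := by
    ext i
    simp
    omega
  rw [this, Fin.card_filter_val_lt]
  omega

theorem rankPow_jordanBlock (a z : ℂ) (k t : ℕ) :
    rankPow (jordanBlock a k) z t = if a = z then k - t else k := by
  unfold rankPow
  rw [jordanBlock_sub_smul_one]
  split_ifs with h
  · rw [h, sub_self, jordanBlock_zero_pow, rank_shift]
  · have hdet : (jordanBlock (a - z) k).det = (a - z) ^ k := by
      rw [det_of_isUpperTriangular]
      · simp [jordanBlock]
      · intro i j hij
        simp only [id] at hij
        simp only [jordanBlock, of_apply]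
        rw [if_neg hij.ne', if_neg]
        have := Fin.lt_def.1 hij
        omega
    rw [rank_of_det_ne_zero]
    · simp
    · rw [det_pow, hdet]
      exact pow_ne_zero _ (pow_ne_zero _ (sub_ne_zero.2 h))

/-- The number of Jordan blocks of size `m + 1` for the eigenvalue `z`, as computed from ranks. -/
noncomputable def blockCount (M : Matrix ι ι ℂ) (z : ℂ) (m : ℕ) : ℤ :=
  rankPow M z m + rankPow M z (m + 2) - 2 * rankPow M z (m + 1)

theorem Similar.blockCount_eq {M : Matrix ι ι ℂ} {N : Matrix κ κ ℂ} (h : Similar M N) (z : ℂ)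
    (m : ℕ) : blockCount M z m = blockCount N z m := by
  simp only [blockCount, h.rankPow_eq]

theorem blockCount_blockDiagonal' {o : Type*} [Fintype o] [DecidableEq o]
    {m : o → Type*} [∀ i, Fintype (m i)] [∀ i, DecidableEq (m i)]
    (B : ∀ i, Matrix (m i) (m i) ℂ) (z : ℂ) (t : ℕ) :
    blockCount (blockDiagonal' B) z t = ∑ i, blockCount (B i) z t := by
  simp only [blockCount, rankPow_blockDiagonal', Finset.sum_sub_distrib, Finset.sum_add_distrib,
    Finset.mul_sum, Nat.cast_sum]

/-- For `a = z` the ranks are the truncated differences `k - t`, a piecewise linear function of `t`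
whose second difference is supported at the kink `t + 1 = k`. For `a ≠ z` the ranks are constant. -/
theorem blockCount_jordanBlock (a z : ℂ) (k t : ℕ) :
    blockCount (jordanBlock a k) z t = if a = z ∧ k = t + 1 then 1 else 0 := by
  simp only [blockCount, rankPow_jordanBlock]
  by_cases h : a = z
  · simp only [h, if_true, true_and]
    split_ifs <;> omega
  · simp only [h, if_false, false_and]
    omega

theorem rankPow_neg (M : Matrix ι ι ℂ) (z : ℂ) (m : ℕ) : rankPow (-M) z m = rankPow M (-z) m := by
  unfold rankPow
  have : -M - z • (1 : Matrix ι ι ℂ) = -(M - (-z) • 1) := by simp; abel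
  rw [this, neg_pow]
  rcases neg_one_pow_eq_or (Matrix ι ι ℂ) m with h | h
  · rw [h, one_mul]
  · rw [h, neg_one_mul, ← neg_one_smul ℂ,
      rank_smul_of_mem_nonZeroDivisors _ (mem_nonZeroDivisors_of_ne_zero (by norm_num))]

theorem blockCount_neg (M : Matrix ι ι ℂ) (z : ℂ) (m : ℕ) :
    blockCount (-M) z m = blockCount M (-z) m := by
  simp only [blockCount, rankPow_neg]

-- Entrywise conjugation is conjugate transposition followed by transposition, and both preserve
-- rank.
open scoped ComplexOrder in
theorem rankPow_map_conj (M : Matrix ι ι ℂ) (z : ℂ) (m : ℕ) :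
    rankPow (M.map (starRingEnd ℂ)) z m = rankPow M (starRingEnd ℂ z) m := by
  unfold rankPow
  rw [← rank_conjTranspose, ← rank_transpose]
  congr 1
  have : M.map (starRingEnd ℂ) - z • (1 : Matrix ι ι ℂ) =
      (starRingEnd ℂ).mapMatrix (M - starRingEnd ℂ z • 1) := by
    ext i j
    simp [Matrix.one_apply]
    split_ifs <;> simp
  rw [this, ← map_pow]
  ext i j
  simp [RingHom.mapMatrix_apply]

theorem blockCount_map_conj (M : Matrix ι ι ℂ) (z : ℂ) (m : ℕ) :
    blockCount (M.map (starRingEnd ℂ)) z m = blockCount M (starRingEnd ℂ z) m := by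
  simp only [blockCount, rankPow_map_conj]

end Rank

/-! ### Existence of the complex Jordan form -/

section JordanForm

open Polynomial

/-- The powers are listed in decreasing order so that multiplication by `X` has its ones above the
diagonal. Substituting `X + a` for `X` turns a linear relation into divisibility by `X ^ e` of a
polynomial of degree less than `e`. -/
theorem linearIndependent_mk_X_sub_C_pow (a : ℂ) (e : ℕ) :
    LinearIndependent ℂ fun j : Fin e =>
      (Submodule.Quotient.mk ((X - C a) ^ (e - 1 - (j : ℕ))) :
        ℂ[X] ⧸ Submodule.span ℂ[X] {(X - C a) ^ e}) := by
  rw [Fintype.linearIndependent_iff]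
  intro g hg i
  have h1 : (∑ j : Fin e, C (g j) * (X - C a) ^ (e - 1 - (j : ℕ))) ∈
      Submodule.span ℂ[X] {(X - C a) ^ e} := by
    rw [← Submodule.Quotient.mk_eq_zero, ← hg]
    simp only [← smul_eq_C_mul, ← Submodule.mkQ_apply, map_sum]
    rfl
  obtain ⟨q, hq⟩ := Submodule.mem_span_singleton.1 h1
  have h2 : X ^ e ∣ ∑ j : Fin e, C (g j) * X ^ (e - 1 - (j : ℕ)) := by
    refine ⟨q.comp (X + C a), ?_⟩
    have := congrArg (compRingHom (X + C a)) hq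
    simp only [smul_eq_mul, map_mul, map_pow, map_sub, map_sum, coe_compRingHom_apply, X_comp,
      C_comp, add_sub_cancel_right] at this
    rw [← this, mul_comm]
  rw [X_pow_dvd_iff] at h2
  have h3 := h2 (e - 1 - i) (by have := i.2; omega)
  rw [finsetSum_coeff, Finset.sum_eq_single i] at h3
  · simpa using h3
  · intro j _ hj
    rw [coeff_C_mul_X_pow, if_neg]
    intro h
    apply hj
    ext
    have := i.2
    have := j.2
    omega
  · simp

/-- Applied with `w t` the class of `(X - a) ^ t`. Column `0` of the block has no entry above the
diagonal, which matches the right side because `w e = 0`. -/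
theorem sum_jordanBlock_smul {V : Type*} [AddCommGroup V] [Module ℂ V] (a : ℂ) {e : ℕ}
    (w : ℕ → V) (hw : w e = 0) (j : Fin e) :
    ∑ i : Fin e, jordanBlock a e i j • w (e - 1 - i) = a • w (e - 1 - j) + w (e - j) := by
  have hj := j.2
  have h1 : ∀ i : Fin e, jordanBlock a e i j • w (e - 1 - i) =
      (if i = j then a • w (e - 1 - i) else 0) +
        (if (i : ℕ) + 1 = j then w (e - 1 - i) else 0) := by
    intro i
    simp only [jordanBlock, of_apply]
    split_ifs with h h'
    · rw [h] at h'
      omega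
    · simp
    · simp
    · simp
  simp only [h1, Finset.sum_add_distrib, Finset.sum_ite_eq', Finset.mem_univ, if_true]
  congr 1
  rcases Nat.eq_zero_or_pos (j : ℕ) with h | h
  · rw [Finset.sum_eq_zero, h, Nat.sub_zero, hw]
    intro i _
    rw [if_neg (by omega)]
  · rw [Finset.sum_eq_single ⟨j - 1, by omega⟩]
    · rw [if_pos (by simp; omega)]
      congr 1
      simp
      omega
    · intro i _ hi
      rw [if_neg]
      intro h'
      apply hi
      ext
      simp
      omega
    · simp

theorem exists_basis_quotient_X_sub_C_pow (a : ℂ) (e : ℕ) :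
    ∃ v : Module.Basis (Fin e) ℂ (ℂ[X] ⧸ Submodule.span ℂ[X] {(X - C a) ^ e}),
      ∀ j, (X : ℂ[X]) • v j = ∑ i, jordanBlock a e i j • v i := by
  have hfin : Fintype.card (Fin e) =
      Module.finrank ℂ (ℂ[X] ⧸ Submodule.span ℂ[X] {(X - C a) ^ e}) := by
    have := finrank_quotient_span_eq_natDegree (f := (X - C a) ^ e)
    rw [natDegree_pow, natDegree_X_sub_C, mul_one] at this
    rw [Fintype.card_fin]
    exact this.symm
  have : Module.Finite ℂ (ℂ[X] ⧸ Submodule.span ℂ[X] {(X - C a) ^ e}) :=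
    ((monic_X_sub_C a).pow e).finite_quotient
  have hli := linearIndependent_mk_X_sub_C_pow a e
  refine ⟨Module.Basis.mk hli (hli.span_eq_top_of_card_eq_finrank' hfin).ge, fun j => ?_⟩
  simp only [Module.Basis.coe_mk]
  have hj := j.2
  rw [sum_jordanBlock_smul a (fun t => (Submodule.Quotient.mk ((X - C a) ^ t) :
        ℂ[X] ⧸ Submodule.span ℂ[X] {(X - C a) ^ e}))
      ((Submodule.Quotient.mk_eq_zero _).2 (Submodule.mem_span_singleton_self _)) j]
  simp only [← Submodule.Quotient.mk_smul, ← Submodule.Quotient.mk_add]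
  congr 1
  have h1 : e - (j : ℕ) = e - 1 - j + 1 := by omega
  rw [h1, pow_succ, smul_eq_mul, smul_eq_C_mul]
  ring

/-- Regard `ℂ^ι` as a torsion `ℂ[X]`-module on which `X` acts by `M`. The structure theorem gives
summands `ℂ[X] / (p ^ e)`, and an irreducible `p` over `ℂ` is associated to some `X - a`. Exponents
may be `0`, so empty blocks are still possible. -/
theorem exists_similar_jordan {ι : Type} [Fintype ι] [DecidableEq ι] (M : Matrix ι ι ℂ) :
    ∃ (o : Type) (_ : Fintype o) (_ : DecidableEq o) (a : o → ℂ) (k : o → ℕ),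
      Similar M (blockDiagonal' fun i => jordanBlock (a i) (k i)) := by
  classical
  obtain ⟨o, ho, p, hp, e, ⟨l⟩⟩ := Module.equiv_directSum_of_isTorsion
    (Module.AEval.isTorsion_of_finiteDimensional ℂ (ι → ℂ) (toLin' M))
  have h1 : ∀ i, ∃ a : ℂ, Submodule.span ℂ[X] {p i ^ e i} =
      Submodule.span ℂ[X] {(X - C a) ^ e i} := by
    intro i
    obtain ⟨a, ha⟩ := exists_root_of_degree_eq_one (IsAlgClosed.degree_eq_one_of_irreducible ℂ (hp i))
    refine ⟨a, Ideal.span_singleton_eq_span_singleton.2 (Associated.pow_pow ?_)⟩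
    exact ((irreducible_X_sub_C a).associated_of_dvd (hp i) (dvd_iff_isRoot.2 ha)).symm
  choose a ha using h1
  have h2 : ∀ i, ∃ v : Module.Basis (Fin (e i)) ℂ (ℂ[X] ⧸ Submodule.span ℂ[X] {p i ^ e i}),
      ∀ j, (X : ℂ[X]) • v j = ∑ t, jordanBlock (a i) (e i) t j • v t := by
    intro i
    rw [ha i]
    exact exists_basis_quotient_X_sub_C_pow _ _
  choose v hv using h2
  let b₁ : Module.Basis (Σ i, Fin (e i)) ℂ
      (DirectSum o fun i => ℂ[X] ⧸ Submodule.span ℂ[X] {p i ^ e i}) := DFinsupp.basis v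
  let b : Module.Basis (Σ i, Fin (e i)) ℂ (ι → ℂ) :=
    b₁.map ((l.restrictScalars ℂ).symm.trans (Module.AEval.of ℂ (ι → ℂ) (toLin' M)).symm)
  have hb₁ : ∀ q, (X : ℂ[X]) • b₁ q =
      ∑ p, (blockDiagonal' fun i => jordanBlock (a i) (e i)) p q • b₁ p := by
    rintro ⟨i, j⟩
    have hs : ∀ p, b₁ p = DirectSum.lof ℂ[X] o _ p.1 (v p.1 p.2) := by
      rintro ⟨i', j'⟩
      apply b₁.repr.injective
      rw [Module.Basis.repr_self]
      ext ⟨i'', j''⟩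
      have : b₁.repr (DirectSum.lof ℂ[X] o _ i' (v i' j')) ⟨i'', j''⟩ =
          (v i'').repr ((DirectSum.lof ℂ[X] o
            (fun i => ℂ[X] ⧸ Submodule.span ℂ[X] {p i ^ e i}) i' (v i' j')) i'') j'' := rfl
      rw [this]
      by_cases h : i'' = i'
      · subst h
        rw [DirectSum.lof_apply, Module.Basis.repr_self]
        simp [Finsupp.single_apply]
      · rw [DirectSum.lof_eq_of, DirectSum.of_eq_of_ne _ _ _ h, map_zero,
          Finsupp.single_eq_of_ne (by rintro ⟨⟩; exact h rfl)]
        rfl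
    rw [Fintype.sum_sigma, Finset.sum_eq_single i]
    · rw [hs, ← map_smul, hv, map_sum]
      refine Finset.sum_congr rfl fun t _ => ?_
      -- `DirectSum.lof` is linear over `ℂ[X]`, so complex scalars pass through it as constant
      -- polynomials.
      rw [hs, blockDiagonal'_apply_eq, ← algebraMap_smul ℂ[X], map_smul, algebraMap_smul]
    · intro i' _ hi'
      refine Finset.sum_eq_zero fun t _ => ?_
      rw [blockDiagonal'_apply_ne _ _ _ hi', zero_smul]
    · simp
  have hb : ∀ q, M *ᵥ b q =
      ∑ p, (blockDiagonal' fun i => jordanBlock (a i) (e i)) p q • b p := by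
    intro q
    have h4 : ∀ p, b p =
        (Module.AEval.of ℂ (ι → ℂ) (toLin' M)).symm ((l.restrictScalars ℂ).symm (b₁ p)) :=
      fun p => rfl
    have h5 : M *ᵥ b q = (Module.AEval.of ℂ (ι → ℂ) (toLin' M)).symm
        ((l.restrictScalars ℂ).symm ((X : ℂ[X]) • b₁ q)) := by
      rw [h4, LinearEquiv.restrictScalars_symm_apply, LinearEquiv.restrictScalars_symm_apply,
        map_smul, Module.AEval.of_symm_X_smul]
      rfl
    rw [h5, hb₁, map_sum, map_sum]
    simp only [h4, map_smul]
  refine ⟨o, ho, inferInstance, a, e, (Pi.basisFun ℂ ι).toMatrix b, b.toMatrix (Pi.basisFun ℂ ι),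
    Module.Basis.toMatrix_mul_toMatrix_flip _ _, Module.Basis.toMatrix_mul_toMatrix_flip _ _, ?_⟩
  ext i q
  have := congrFun (hb q) i
  rw [Finset.sum_apply] at this
  simpa [Matrix.mul_apply, mulVec, dotProduct, Module.Basis.toMatrix_apply, mul_comm] using this

end JordanForm

/-! ### Block counts classify complex matrices up to similarity -/

theorem similar_blockDiagonal'_comp {R : Type*} [Ring R] {o o' : Type*} [Fintype o]
    [DecidableEq o] [Fintype o'] [DecidableEq o'] {m : o' → Type*} [∀ i, Fintype (m i)]
    [∀ i, DecidableEq (m i)] (B : ∀ i, Matrix (m i) (m i) R) (g : o → o')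
    (hg : Function.Injective g) (hg' : ∀ j, (∀ i, g i ≠ j) → IsEmpty (m j)) :
    Similar (blockDiagonal' fun i => B (g i)) (blockDiagonal' B) := by
  let F : (Σ i, m (g i)) ≃ Σ j, m j := Equiv.ofBijective (fun p => ⟨g p.1, p.2⟩) (by
    constructor
    · rintro ⟨i, x⟩ ⟨j, y⟩ h
      obtain rfl : i = j := hg (congrArg Sigma.fst h)
      simpa using h
    · rintro ⟨j, x⟩
      by_cases h : ∃ i, g i = j
      · obtain ⟨i, rfl⟩ := h
        exact ⟨⟨i, x⟩, rfl⟩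
      · exact ((hg' j (by simpa using h)).false x).elim)
  have : (blockDiagonal' fun i => B (g i)) = (blockDiagonal' B).submatrix F F := by
    ext ⟨i, x⟩ ⟨j, y⟩
    change _ = blockDiagonal' B ⟨g i, x⟩ ⟨g j, y⟩
    by_cases h : i = j
    · subst h
      rw [blockDiagonal'_apply_eq, blockDiagonal'_apply_eq]
    · rw [blockDiagonal'_apply_ne _ _ _ h, blockDiagonal'_apply_ne _ _ _ fun h' => h (hg h')]
  rw [this]
  exact similar_submatrix _ F

theorem exists_similar_jordan_pos {ι : Type} [Fintype ι] [DecidableEq ι] (M : Matrix ι ι ℂ) :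
    ∃ (o : Type) (_ : Fintype o) (_ : DecidableEq o) (b : o → ℂ × ℕ), (∀ i, 0 < (b i).2) ∧
      Similar M (blockDiagonal' fun i => jordanBlock (b i).1 (b i).2) := by
  obtain ⟨o, _, _, a, k, h⟩ := exists_similar_jordan M
  refine ⟨{i // 0 < k i}, inferInstance, inferInstance, fun i => (a i, k i), fun i => i.2,
    h.trans (Similar.symm ?_)⟩
  refine similar_blockDiagonal'_comp (fun i => jordanBlock (a i) (k i)) Subtype.val
    Subtype.val_injective fun j hj => ?_
  exact ⟨fun x => hj ⟨j, x.pos⟩ rfl⟩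

theorem blockCount_jordan {o : Type*} [Fintype o] [DecidableEq o] (b : o → ℂ × ℕ) (z : ℂ)
    (m : ℕ) : blockCount (blockDiagonal' fun i => jordanBlock (b i).1 (b i).2) z m =
      Fintype.card {i // b i = (z, m + 1)} := by
  rw [blockCount_blockDiagonal', Fintype.card_subtype, Finset.card_filter, Nat.cast_sum]
  refine Finset.sum_congr rfl fun i _ => ?_
  rw [blockCount_jordanBlock]
  simp [Prod.ext_iff]

theorem blockCount_nonneg {ι : Type} [Fintype ι] [DecidableEq ι] (M : Matrix ι ι ℂ) (z : ℂ)
    (m : ℕ) : 0 ≤ blockCount M z m := by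
  obtain ⟨o, _, _, b, -, h⟩ := exists_similar_jordan_pos M
  rw [h.blockCount_eq, blockCount_jordan]
  exact Int.natCast_nonneg _

theorem finite_blockCount_ne_zero {ι : Type} [Fintype ι] [DecidableEq ι] (M : Matrix ι ι ℂ) :
    {p : ℂ × ℕ | blockCount M p.1 p.2 ≠ 0}.Finite := by
  obtain ⟨o, _, _, b, -, h⟩ := exists_similar_jordan_pos M
  refine (Set.finite_range fun i => ((b i).1, (b i).2 - 1)).subset ?_
  rintro ⟨z, m⟩ hp
  rw [Set.mem_ofPred_eq, h.blockCount_eq, blockCount_jordan, Nat.cast_ne_zero] at hp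
  obtain ⟨i, hi⟩ := Fintype.card_pos_iff.1 (Nat.pos_of_ne_zero hp)
  exact ⟨i, by simp [hi]⟩

/-- Equal counts give bijections between the blocks of each type, which glue to a bijection between
the two families of blocks. -/
theorem similar_of_blockCount_eq {ι κ : Type} [Fintype ι] [DecidableEq ι] [Fintype κ]
    [DecidableEq κ] {M : Matrix ι ι ℂ} {N : Matrix κ κ ℂ}
    (h : ∀ z m, blockCount M z m = blockCount N z m) : Similar M N := by
  obtain ⟨o, _, _, b, hb, hM⟩ := exists_similar_jordan_pos M
  obtain ⟨o', _, _, b', hb', hN⟩ := exists_similar_jordan_pos N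
  have hcard : ∀ c, Nonempty ({i // b i = c} ≃ {i // b' i = c}) := by
    rintro ⟨z, k⟩
    rw [← Fintype.card_eq]
    rcases k with - | m
    -- `blockCount` at `m` concerns size `m + 1`, so size `0` has to be excluded by positivity of
    -- the blocks.
    · have h1 : IsEmpty {i // b i = (z, 0)} := ⟨fun i => (hb i).ne' (by rw [i.2])⟩
      have h2 : IsEmpty {i // b' i = (z, 0)} := ⟨fun i => (hb' i).ne' (by rw [i.2])⟩
      simp
    · have := h z m
      rw [hM.blockCount_eq, hN.blockCount_eq, blockCount_jordan, blockCount_jordan] at this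
      exact_mod_cast this
  let e : o ≃ o' := Equiv.ofFiberEquiv fun c => (hcard c).some
  have he : b = fun i => b' (e i) := funext fun i => (Equiv.ofFiberEquiv_map _ i).symm
  refine hM.trans (Similar.trans ?_ hN.symm)
  rw [he]
  exact similar_blockDiagonal'_comp (fun i => jordanBlock (b' i).1 (b' i).2) e e.injective
    fun j hj => (hj (e.symm j) (by simp)).elim

/-! ### Complexification of matrices over a real algebra -/

section Complexify

variable {D : Type*} [Ring D] [Algebra ℝ D] {d : ℕ} (φ : D →ₐ[ℝ] Matrix (Fin d) (Fin d) ℂ)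
  {ι κ τ : Type*}

/-- Replace every entry of a matrix over `D` by its image in the complex `d × d` matrices. -/
noncomputable def complexify (A : Matrix ι κ D) : Matrix (ι × Fin d) (κ × Fin d) ℂ :=
  of fun p q => φ (A p.1 q.1) p.2 q.2

theorem complexify_mul [Fintype κ] (A : Matrix ι κ D) (B : Matrix κ τ D) :
    complexify φ (A * B) = complexify φ A * complexify φ B := by
  ext p q
  simp only [complexify, of_apply, Matrix.mul_apply, map_sum, map_mul, Matrix.sum_apply,
    Fintype.sum_prod_type]

theorem complexify_one [DecidableEq ι] : complexify φ (1 : Matrix ι ι D) = 1 := by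
  ext ⟨i, a⟩ ⟨j, b⟩
  simp only [complexify, of_apply, Matrix.one_apply, Prod.ext_iff]
  split_ifs with h1 h2 h2 <;> simp_all

theorem complexify_add (A B : Matrix ι κ D) :
    complexify φ (A + B) = complexify φ A + complexify φ B := by
  ext p q
  simp [complexify]

theorem complexify_neg (A : Matrix ι κ D) : complexify φ (-A) = -complexify φ A := by
  ext p q
  simp [complexify]

theorem complexify_sub (A B : Matrix ι κ D) :
    complexify φ (A - B) = complexify φ A - complexify φ B := by
  ext p q
  simp [complexify]

theorem complexify_smul (t : ℝ) (A : Matrix ι κ D) :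
    complexify φ (t • A) = (t : ℂ) • complexify φ A := by
  ext p q
  simp [complexify]

theorem complexify_pow [Fintype ι] [DecidableEq ι] (A : Matrix ι ι D) (m : ℕ) :
    complexify φ (A ^ m) = complexify φ A ^ m := by
  induction m with
  | zero => rw [pow_zero, pow_zero, complexify_one]
  | succ m ih => rw [pow_succ, pow_succ, complexify_mul, ih]

theorem Similar.complexify [Fintype ι] [DecidableEq ι] [Fintype κ] [DecidableEq κ]
    {X : Matrix ι ι D} {Y : Matrix κ κ D} (h : Similar X Y) :
    Similar (complexify φ X) (complexify φ Y) := by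
  obtain ⟨P, Q, h1, h2, h3⟩ := h
  refine ⟨AdjointReality.complexify φ P, AdjointReality.complexify φ Q, ?_, ?_, ?_⟩
  · rw [← complexify_mul, h1, complexify_one]
  · rw [← complexify_mul, h2, complexify_one]
  · rw [← complexify_mul, h3, complexify_mul]

theorem similar_complexify_blockDiagonal' {o : Type*} [Fintype o] [DecidableEq o] {m : o → Type*}
    [∀ i, Fintype (m i)] [∀ i, DecidableEq (m i)] (B : ∀ i, Matrix (m i) (m i) D) :
    Similar (complexify φ (blockDiagonal' B)) (blockDiagonal' fun i => complexify φ (B i)) := by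
  have : complexify φ (blockDiagonal' B) =
      (blockDiagonal' fun i => complexify φ (B i)).submatrix
        (Equiv.sigmaProdDistrib m (Fin d)) (Equiv.sigmaProdDistrib m (Fin d)) := by
    ext ⟨⟨i, x⟩, a⟩ ⟨⟨j, y⟩, b⟩
    change φ (blockDiagonal' B ⟨i, x⟩ ⟨j, y⟩) a b =
      blockDiagonal' (fun i => complexify φ (B i)) ⟨i, (x, a)⟩ ⟨j, (y, b)⟩
    by_cases h : i = j
    · subst h
      rw [blockDiagonal'_apply_eq, blockDiagonal'_apply_eq]
      rfl
    · rw [blockDiagonal'_apply_ne _ _ _ h, blockDiagonal'_apply_ne _ _ _ h, map_zero]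
      rfl
  rw [this]
  exact similar_submatrix _ _

/-- The complex `d × d` matrices are the complexification of the image of `φ`. -/
structure IsComplexification : Prop where
  exists_eq (A : Matrix (Fin d) (Fin d) ℂ) : ∃ p q : D, φ p + Complex.I • φ q = A
  eq_zero (p q : D) (h : φ p + Complex.I • φ q = 0) : p = 0 ∧ q = 0

variable {φ}

theorem IsComplexification.exists_complexify_eq (hφ : IsComplexification φ)
    (A : Matrix (ι × Fin d) (κ × Fin d) ℂ) :
    ∃ P Q : Matrix ι κ D, complexify φ P + Complex.I • complexify φ Q = A := by
  choose p q h using fun i j => hφ.exists_eq (of fun a b => A (i, a) (j, b))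
  refine ⟨of p, of q, ?_⟩
  ext ⟨i, a⟩ ⟨j, b⟩
  have := congrFun (congrFun (h i j) a) b
  simpa [complexify] using this

theorem IsComplexification.complexify_inj (hφ : IsComplexification φ) {P Q P' Q' : Matrix ι κ D}
    (h : complexify φ P + Complex.I • complexify φ Q =
      complexify φ P' + Complex.I • complexify φ Q') : P = P' ∧ Q = Q' := by
  have h0 : ∀ i j, P i j - P' i j = 0 ∧ Q i j - Q' i j = 0 := by
    intro i j
    apply hφ.eq_zero
    ext a b
    have := congrFun (congrFun h (i, a)) (j, b)
    simp only [complexify, Matrix.add_apply, Matrix.smul_apply, of_apply, smul_eq_mul] at this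
    simp only [map_sub, Matrix.add_apply, Matrix.smul_apply, Matrix.sub_apply, Matrix.zero_apply,
      smul_eq_mul]
    linear_combination this
  exact ⟨by ext i j; exact sub_eq_zero.1 (h0 i j).1, by ext i j; exact sub_eq_zero.1 (h0 i j).2⟩

/-- The determinant is a polynomial in the parameter, nonzero because of its value at `z`; its
finitely many roots cannot contain all reals. -/
theorem exists_real_det_add_smul_ne_zero [Fintype ι] [DecidableEq ι] (A B : Matrix ι ι ℂ) (z : ℂ)
    (h : (A + z • B).det ≠ 0) : ∃ t : ℝ, (A + (t : ℂ) • B).det ≠ 0 := by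
  let f : Polynomial ℂ := (A.map Polynomial.C + (Polynomial.X : Polynomial ℂ) •
    B.map Polynomial.C).det
  have hf : ∀ w : ℂ, f.eval w = (A + w • B).det := by
    intro w
    rw [← Polynomial.coe_evalRingHom, RingHom.map_det]
    congr 1
    ext i j
    simp
    exact mul_comm _ _
  have hf0 : f ≠ 0 := by
    intro h0
    apply h
    rw [← hf, h0, Polynomial.eval_zero]
  by_contra! hall
  have hinf : (Set.range fun t : ℝ => (t : ℂ)).Infinite :=
    Set.infinite_range_of_injective Complex.ofReal_injective
  apply hinf
  refine (f.roots.toFinset.finite_toSet).subset ?_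
  rintro _ ⟨t, rfl⟩
  simp only [Finset.mem_coe, Multiset.mem_toFinset, Polynomial.mem_roots hf0, Polynomial.IsRoot]
  rw [hf, hall]

theorem IsComplexification.similar_of_complexify [Fintype ι] [DecidableEq ι]
    (hφ : IsComplexification φ) {X Y : Matrix ι ι D}
    (h : Similar (complexify φ X) (complexify φ Y)) : Similar X Y := by
  obtain ⟨A, B, h1, h2, h3⟩ := h
  obtain ⟨P, Q, rfl⟩ := hφ.exists_complexify_eq A
  simp only [Matrix.mul_add, Matrix.add_mul, Matrix.mul_smul, Matrix.smul_mul,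
    ← complexify_mul] at h3
  -- Uniqueness of the two components makes `P` and `Q` separately intertwine `X` and `Y`.
  obtain ⟨hP, hQ⟩ := hφ.complexify_inj h3
  have hdet : (complexify φ P + Complex.I • complexify φ Q).det ≠ 0 :=
    (isUnit_iff_isUnit_det _).1 (IsUnit.of_mul_eq_one _ h1) |>.ne_zero
  obtain ⟨t, ht⟩ := exists_real_det_add_smul_ne_zero _ _ _ hdet
  have hU : IsUnit (complexify φ (P + t • Q)) := by
    rw [isUnit_iff_isUnit_det, complexify_add, complexify_smul]
    exact ht.isUnit
  obtain ⟨V, hV⟩ := hU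
  -- The inverse is decomposed as well; comparing first components shows that `P'` already inverts
  -- `P + t • Q` over `D`.
  obtain ⟨P', Q', hV'⟩ := hφ.exists_complexify_eq (ι := ι) (κ := ι) ((V⁻¹ : (Matrix _ _ ℂ)ˣ) : Matrix _ _ ℂ)
  have h4 := V.mul_inv
  have h5 := V.inv_mul
  have h01 : (1 : Matrix (ι × Fin d) (ι × Fin d) ℂ) =
      complexify φ (1 : Matrix ι ι D) + Complex.I • complexify φ (0 : Matrix ι ι D) := by
    rw [complexify_one]
    ext p q
    simp [complexify]
  rw [hV, ← hV', h01] at h4 h5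
  simp only [Matrix.mul_add, Matrix.add_mul, Matrix.mul_smul, Matrix.smul_mul,
    ← complexify_mul] at h4 h5
  refine ⟨P + t • Q, P', ?_, ?_, ?_⟩
  · exact (hφ.complexify_inj (by simpa only [Matrix.add_mul, Matrix.smul_mul] using h4)).1
  · exact (hφ.complexify_inj (by simpa only [Matrix.mul_add, Matrix.mul_smul] using h5)).1
  · rw [Matrix.mul_add, Matrix.add_mul, Matrix.mul_smul, Matrix.smul_mul, hP, hQ]

end Complexify

/-! ### Direct sums -/

section DirectSum

variable {D : Type*} [Ring D] {n k : ℕ}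

theorem isAdReal_iff_similar (X : Matrix (Fin n) (Fin n) D) : IsAdReal X ↔ Similar X (-X) :=
  ⟨fun ⟨g, hg⟩ => (similar_of_units g hg).symm, fun h => h.symm.exists_units⟩

theorem IsConjToDirectSum.similar {X : Matrix (Fin n) (Fin n) D} {size : Fin k → ℕ}
    {B : (i : Fin k) → Matrix (Fin (size i)) (Fin (size i)) D} (h : IsConjToDirectSum X size B) :
    Similar X (blockDiagonal' B) := by
  obtain ⟨h, S, hS⟩ := h
  refine (similar_of_units S hS).symm.trans ?_
  rw [reindex_apply]
  exact similar_submatrix _ _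

theorem isConjToDirectSum_of_similar {X : Matrix (Fin n) (Fin n) D} {size : Fin k → ℕ}
    {B : (i : Fin k) → Matrix (Fin (size i)) (Fin (size i)) D} (hn : ∑ i, size i = n)
    (h : Similar (reindex (finSigmaFinEquiv.trans (finCongr hn))
      (finSigmaFinEquiv.trans (finCongr hn)) (blockDiagonal' B)) X) :
    IsConjToDirectSum X size B :=
  ⟨hn, h.exists_units⟩

end DirectSum

/-! ### Partitions into pairs and singletons -/

section Partition

variable {β : Type*} {σ : β → β}

open Classical in
/-- The number of members of the family `b` in `S` that are equal to `x`. -/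
noncomputable def countIn {ι : Type*} (S : Finset ι) (b : ι → β) (x : β) : ℕ :=
  ∑ i ∈ S, if b i = x then 1 else 0

-- Induction on `S`: a member fixed by `σ` is split off alone. Any other `b i` has a partner, since
-- `σ (b i)` occurs as often as `b i`, and removing both keeps the counts `σ`-invariant.
open Classical in
theorem exists_finpartition_of_countIn_eq (hσ : Function.Involutive σ) {ι : Type*} [DecidableEq ι]
    (b : ι → β) (S : Finset ι) (h : ∀ x, countIn S b x = countIn S b (σ x)) :
    ∃ P : Finpartition S, ∀ p ∈ P.parts,
      (∃ i j, i ≠ j ∧ p = {i, j} ∧ σ (b i) ≠ b i ∧ b j = σ (b i)) ∨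
        (∃ i, p = {i} ∧ σ (b i) = b i) := by
  induction S using Finset.strongInduction with
  | H S ih =>
    rcases S.eq_empty_or_nonempty with rfl | ⟨i, hi⟩
    · exact ⟨Finpartition.empty _, by simp⟩
    have h1 : ∀ x, countIn S b x = (if b i = x then 1 else 0) + countIn (S.erase i) b x :=
      fun x => (Finset.add_sum_erase S _ hi).symm
    by_cases hfix : σ (b i) = b i
    · obtain ⟨P, hP⟩ := ih (S.erase i) (Finset.erase_ssubset hi) (fun x => by
        have := h x
        rw [h1, h1] at this
        have h2 : b i = x ↔ b i = σ x := by rw [← hσ.eq_iff, hfix]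
        simpa only [h2, add_right_inj] using this)
      refine ⟨P.extend (b := {i}) (c := S) (by simp) (by simp) ?_, fun p hp => ?_⟩
      · rw [Finset.sup_eq_union, Finset.union_comm, ← Finset.insert_eq, Finset.insert_erase hi]
      · rcases Finset.mem_insert.1 hp with rfl | hp
        · exact Or.inr ⟨i, rfl, hfix⟩
        · exact hP p hp
    · have hpos : 0 < countIn S b (σ (b i)) := by
        rw [← h, h1, if_pos rfl]
        omega
      obtain ⟨j, hj, hij⟩ : ∃ j ∈ S, b j = σ (b i) := by
        by_contra! hno
        refine hpos.ne' (Finset.sum_eq_zero fun j hj => if_neg (hno j hj))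
      have hne : j ≠ i := by
        rintro rfl
        exact hfix hij.symm
      have hj' : j ∈ S.erase i := Finset.mem_erase.2 ⟨hne, hj⟩
      have h2 : ∀ x, countIn (S.erase i) b x =
          (if b j = x then 1 else 0) + countIn ((S.erase i).erase j) b x :=
        fun x => (Finset.add_sum_erase _ _ hj').symm
      obtain ⟨P, hP⟩ := ih ((S.erase i).erase j)
        ((Finset.erase_ssubset hj').trans (Finset.erase_ssubset hi)) (fun x => by
          have := h x
          rw [h1, h1, h2, h2, hij] at this
          have e1 : σ (b i) = σ x ↔ b i = x := hσ.injective.eq_iff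
          have e2 : b i = σ x ↔ σ (b i) = x := (hσ.eq_iff).symm
          simp only [e1, e2] at this
          omega)
      refine ⟨P.extend (b := {i, j}) (c := S) (by simp) ?_ ?_, fun p hp => ?_⟩
      · simp
      · ext x
        simp only [Finset.sup_eq_union, Finset.mem_union, Finset.mem_erase, Finset.mem_insert,
          Finset.mem_singleton]
        by_cases hxi : x = i
        · simp [hxi, hi]
        · by_cases hxj : x = j <;> simp [hxi, hxj, hj]
      · rcases Finset.mem_insert.1 hp with rfl | hp
        · exact Or.inl ⟨i, j, hne.symm, rfl, hfix, hij⟩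
        · exact hP p hp

-- For the forward direction, each pair and each fixed singleton contributes equally to the counts
-- at `x` and at `σ x`.
open Classical in
theorem canBePartitioned_iff_countIn (hσ : Function.Involutive σ) {k : ℕ} (b : Fin k → β) :
    CanBePartitioned b (fun x y => σ x ≠ x ∧ y = σ x) (fun x => σ x = x) ↔
      ∀ x, countIn Finset.univ b x = countIn Finset.univ b (σ x) := by
  constructor
  · rintro ⟨P, hP⟩ x
    have hsum : ∀ y, countIn Finset.univ b y = ∑ p ∈ P.parts, countIn p b y := by
      intro y
      exact (congrArg (fun s => countIn s b y) P.biUnion_parts).symm.trans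
        (Finset.sum_biUnion P.disjoint)
    rw [hsum, hsum]
    refine Finset.sum_congr rfl fun p hp => ?_
    rcases hP p hp with ⟨i, j, hij, rfl, -, hb⟩ | ⟨i, rfl, hb⟩
    · simp only [countIn, Finset.sum_pair hij, hb, hσ.injective.eq_iff]
      have e2 : b i = σ x ↔ σ (b i) = x := (hσ.eq_iff).symm
      simp only [e2, add_comm]
    · simp only [countIn, Finset.sum_singleton]
      have h2 : b i = x ↔ b i = σ x := by rw [← hσ.eq_iff, hb]
      simp only [h2]
  · intro h
    exact (exists_finpartition_of_countIn_eq hσ b Finset.univ h)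

theorem exists_family_countIn_eq (g : β → ℕ) (hg : (Function.support g).Finite) :
    ∃ (k : ℕ) (b : Fin k → β), ∀ x, countIn Finset.univ b x = g x := by
  classical
  let s : Multiset β := Finsupp.toMultiset (Finsupp.ofSupportFinite g hg)
  refine ⟨s.toList.length, s.toList.get, fun x => ?_⟩
  have h1 : (Finset.univ.val.map s.toList.get : Multiset β) = s := by
    rw [Fin.univ_val_map, List.ofFn_get, Multiset.coe_toList]
  have h2 : s.count x = g x := by
    rw [Finsupp.count_toMultiset]
    rfl
  calc countIn Finset.univ s.toList.get x = (Finset.univ.val.map s.toList.get).count x := by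
        rw [Multiset.count_map, countIn, ← Finset.card_filter]
        simp only [Finset.card, Finset.filter_val, eq_comm]
    _ = g x := by rw [h1, h2]

end Partition

/-! ### Jordan forms over a real algebra -/

section BlockSystem

variable {D : Type} [Ring D] [Algebra ℝ D] {d : ℕ} (φ : D →ₐ[ℝ] Matrix (Fin d) (Fin d) ℂ)
  {β : Type} (size : β → ℕ) (mat : (x : β) → Matrix (Fin (size x)) (Fin (size x)) D)
  (σ : β → β) (key : β → ℂ × ℕ)

/-- A system of blocks over `D` such that the multiplicities of the blocks in a direct sum can be
read off the complex Jordan form, the multiplicity of `x` at the complex Jordan blocks given by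
`key x`, and such that `σ` corresponds to multiplication by `-1`. -/
structure IsBlockSystem : Prop where
  dim_pos : 0 < d
  similar_of_complexify {n : ℕ} {X Y : Matrix (Fin n) (Fin n) D} :
    Similar (complexify φ X) (complexify φ Y) → Similar X Y
  involutive : Function.Involutive σ
  key_pos (x : β) : 0 < blockCount (complexify φ (mat x)) (key x).1 (key x).2
  key_ne {x y : β} (h : x ≠ y) : blockCount (complexify φ (mat x)) (key y).1 (key y).2 = 0
  neg (x : β) (z : ℂ) (m : ℕ) : blockCount (complexify φ (mat (σ x))) z m =
    blockCount (complexify φ (mat x)) (-z) m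
  -- The keys suffice to recover all counts of matrices over `D`; for `ℝ` and `ℍ` this rests on
  -- symmetry under complex conjugation.
  exists_key (z : ℂ) (m : ℕ) : ∃ x, ∀ (n : ℕ) (X : Matrix (Fin n) (Fin n) D),
    blockCount (complexify φ X) z m = blockCount (complexify φ X) (key x).1 (key x).2
  -- Integrality of the multiplicities read off from an arbitrary `X`, needed for the existence of a
  -- Jordan form.
  dvd (x : β) {n : ℕ} (X : Matrix (Fin n) (Fin n) D) :
    blockCount (complexify φ (mat x)) (key x).1 (key x).2 ∣
      blockCount (complexify φ X) (key x).1 (key x).2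

variable {φ size mat σ key}

theorem blockCount_complexify_blockDiagonal' {k : ℕ} (b : Fin k → β) (z : ℂ) (m : ℕ) :
    blockCount (complexify φ (blockDiagonal' fun i => mat (b i))) z m =
      ∑ i, blockCount (complexify φ (mat (b i))) z m := by
  rw [(similar_complexify_blockDiagonal' φ _).blockCount_eq, blockCount_blockDiagonal']

namespace IsBlockSystem

variable (h : IsBlockSystem φ size mat σ key)

include h

theorem key_injective : Function.Injective key := by
  intro x y hxy
  by_contra hne
  have h1 := h.key_pos x
  rw [hxy, h.key_ne hne] at h1
  exact h1.false

theorem sum_blockCount_key {k : ℕ} (b : Fin k → β) (x : β) :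
    ∑ i, blockCount (complexify φ (mat (b i))) (key x).1 (key x).2 =
      countIn Finset.univ b x * blockCount (complexify φ (mat x)) (key x).1 (key x).2 := by
  classical
  rw [countIn, Nat.cast_sum, Finset.sum_mul]
  refine Finset.sum_congr rfl fun i _ => ?_
  by_cases hi : b i = x
  · rw [if_pos hi, hi, Nat.cast_one, one_mul]
  · rw [if_neg hi, h.key_ne hi, Nat.cast_zero, zero_mul]

/-- At `key x` the counts of `X` and `-X` are the multiplicities of `x` and of `σ x`, both times the
same positive number. -/
theorem isAdReal_iff {n k : ℕ} {X : Matrix (Fin n) (Fin n) D} {b : Fin k → β}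
    (hX : IsConjToDirectSum X (fun i => size (b i)) (fun i => mat (b i))) :
    IsAdReal X ↔ CanBePartitioned b (fun x y => σ x ≠ x ∧ y = σ x) (fun x => σ x = x) := by
  rw [canBePartitioned_iff_countIn h.involutive, isAdReal_iff_similar]
  have h1 : ∀ z m, blockCount (complexify φ X) z m =
      ∑ i, blockCount (complexify φ (mat (b i))) z m := fun z m => by
    rw [(hX.similar.complexify φ).blockCount_eq, blockCount_complexify_blockDiagonal']
  have h2 : ∀ z m, blockCount (complexify φ (-X)) z m =
      ∑ i, blockCount (complexify φ (mat (σ (b i)))) z m := fun z m => by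
    simp only [complexify_neg, blockCount_neg, h1, h.neg]
  have h3 : ∀ x, countIn Finset.univ (fun i => σ (b i)) x = countIn Finset.univ b (σ x) := by
    intro x
    classical
    unfold countIn
    exact Finset.sum_congr rfl fun i _ => if_congr h.involutive.eq_iff rfl rfl
  have h4 : ∀ x, blockCount (complexify φ X) (key x).1 (key x).2 =
      countIn Finset.univ b x * blockCount (complexify φ (mat x)) (key x).1 (key x).2 :=
    fun x => by rw [h1, h.sum_blockCount_key]
  have h5 : ∀ x, blockCount (complexify φ (-X)) (key x).1 (key x).2 =
      countIn Finset.univ b (σ x) * blockCount (complexify φ (mat x)) (key x).1 (key x).2 :=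
    fun x => by rw [h2, h.sum_blockCount_key (fun i => σ (b i)), h3]
  constructor
  · intro hs x
    have := (hs.complexify φ).blockCount_eq (key x).1 (key x).2
    rw [h4, h5] at this
    exact_mod_cast mul_right_cancel₀ (h.key_pos x).ne' this
  · intro hc
    refine h.similar_of_complexify (similar_of_blockCount_eq fun z m => ?_)
    obtain ⟨x, hx⟩ := h.exists_key z m
    rw [hx, hx, h4, h5, hc]

theorem exists_isConjToDirectSum {n : ℕ} (X : Matrix (Fin n) (Fin n) D) :
    ∃ (k : ℕ) (b : Fin k → β),
      IsConjToDirectSum X (fun i => size (b i)) (fun i => mat (b i)) := by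
  have hg : ∀ x, ∃ c : ℕ, (c : ℤ) * blockCount (complexify φ (mat x)) (key x).1 (key x).2 =
      blockCount (complexify φ X) (key x).1 (key x).2 := by
    intro x
    -- Neither the division nor `toNat` loses anything, by `dvd` and nonnegativity.
    refine ⟨(blockCount (complexify φ X) (key x).1 (key x).2 /
      blockCount (complexify φ (mat x)) (key x).1 (key x).2).toNat, ?_⟩
    rw [Int.toNat_of_nonneg (Int.ediv_nonneg (blockCount_nonneg _ _ _) (h.key_pos x).le),
      Int.ediv_mul_cancel (h.dvd x X)]
  choose g hgmul using hg
  have hfin : (Function.support g).Finite := by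
    refine ((finite_blockCount_ne_zero (complexify φ X)).preimage
      h.key_injective.injOn).subset fun x hx => ?_
    rw [Set.mem_preimage, Set.mem_ofPred_eq, ← hgmul]
    exact mul_ne_zero (by exact_mod_cast hx) (h.key_pos x).ne'
  obtain ⟨k, b, hb⟩ := exists_family_countIn_eq g hfin
  have hs : Similar (complexify φ X) (complexify φ (blockDiagonal' fun i => mat (b i))) := by
    refine similar_of_blockCount_eq fun z m => ?_
    obtain ⟨x, hx⟩ := h.exists_key z m
    rw [blockCount_complexify_blockDiagonal', hx n X, ← hgmul, ← hb, ← h.sum_blockCount_key]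
    exact Finset.sum_congr rfl fun i _ => (hx _ _).symm
  have hn : ∑ i, size (b i) = n := by
    have := hs.card_eq
    simp only [Fintype.card_prod, Fintype.card_sigma, Fintype.card_fin] at this
    exact (Nat.eq_of_mul_eq_mul_right h.dim_pos this).symm
  have hY : Similar (reindex (finSigmaFinEquiv.trans (finCongr hn))
      (finSigmaFinEquiv.trans (finCongr hn)) (blockDiagonal' fun i => mat (b i)))
      (blockDiagonal' fun i => mat (b i)) := by
    rw [reindex_apply]
    exact similar_submatrix _ _
  exact ⟨k, b, isConjToDirectSum_of_similar hn
    (h.similar_of_complexify ((hY.complexify φ).trans hs.symm))⟩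

end IsBlockSystem

end BlockSystem

/-- If a matrix is made of the two blocks `J(z, m)` and `J(conj z, m)`, so are its block counts. -/
theorem blockCount_of_conj_pair {m : ℕ} {M : Matrix (Fin m × Fin 2) (Fin m × Fin 2) ℂ} {z : ℂ}
    (hM : ∀ i a j b, M (i, a) (j, b) =
      if a = b then jordanBlock (if a = 0 then z else starRingEnd ℂ z) m i j else 0)
    (w : ℂ) (t : ℕ) :
    blockCount M w t = (if z = w ∧ m = t + 1 then 1 else 0) +
      if starRingEnd ℂ z = w ∧ m = t + 1 then 1 else 0 := by
  let B : Fin 2 → Matrix (Fin m) (Fin m) ℂ :=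
    fun a => jordanBlock (if a = 0 then z else starRingEnd ℂ z) m
  let e : Fin m × Fin 2 ≃ Σ _ : Fin 2, Fin m :=
    (Equiv.prodComm _ _).trans (Equiv.sigmaEquivProd _ _).symm
  have h1 : M = (blockDiagonal' B).submatrix e e := by
    ext ⟨i, a⟩ ⟨j, b⟩
    change _ = blockDiagonal' B ⟨a, i⟩ ⟨b, j⟩
    rw [hM]
    by_cases h : a = b
    · subst h
      rw [blockDiagonal'_apply_eq, if_pos rfl]
    · rw [blockDiagonal'_apply_ne _ _ _ h, if_neg h]
  rw [h1, (similar_submatrix _ e).blockCount_eq, blockCount_blockDiagonal', Fin.sum_univ_two,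
    blockCount_jordanBlock, blockCount_jordanBlock, if_pos rfl, if_neg one_ne_zero]

/-! ### The complex case -/

/-- The complex numbers as complex `1 × 1` matrices. -/
noncomputable def complexToMatrix : ℂ →ₐ[ℝ] Matrix (Fin 1) (Fin 1) ℂ :=
  (Algebra.ofId ℂ (Matrix (Fin 1) (Fin 1) ℂ)).restrictScalars ℝ

theorem complexify_complexToMatrix {ι : Type*} (A : Matrix ι ι ℂ) :
    complexify complexToMatrix A =
      A.submatrix (Equiv.prodUnique ι (Fin 1)) (Equiv.prodUnique ι (Fin 1)) := by
  ext ⟨i, a⟩ ⟨j, b⟩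
  rw [Subsingleton.elim a b]
  simp [complexify, complexToMatrix, Algebra.ofId_apply, Matrix.algebraMap_matrix_apply]

theorem similar_complexify_complexToMatrix {ι : Type*} [Fintype ι] [DecidableEq ι]
    (A : Matrix ι ι ℂ) : Similar (complexify complexToMatrix A) A := by
  rw [complexify_complexToMatrix]
  exact similar_submatrix _ _

/-- The block `J(-λ, m)`. -/
def ComplexBlock.neg (b : ComplexBlock) : ComplexBlock := ⟨-b.lam, b.m, b.hm⟩

/-- Complexification is only a reindexing here, so descent is immediate. Blocks are nonempty, so
`b.m - 1` in the key is a genuine predecessor. -/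
theorem isBlockSystem_complexBlock :
    IsBlockSystem complexToMatrix ComplexBlock.m (fun b => jordanBlock b.lam b.m)
      ComplexBlock.neg (fun b => (b.lam, b.m - 1)) := by
  have hw : ∀ (b : ComplexBlock) (z : ℂ) (t : ℕ),
      blockCount (complexify complexToMatrix (jordanBlock b.lam b.m)) z t =
        if b.lam = z ∧ b.m = t + 1 then 1 else 0 := fun b z t => by
    rw [(similar_complexify_complexToMatrix _).blockCount_eq, blockCount_jordanBlock]
  refine ⟨one_pos, fun h => ?_, fun b => ?_, fun b => ?_, fun {b c} h => ?_, fun b z t => ?_,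
    fun z m => ⟨⟨z, m + 1, m.succ_pos⟩, fun n X => rfl⟩, fun b n X => ?_⟩
  · exact ((similar_complexify_complexToMatrix _).symm.trans h).trans
      (similar_complexify_complexToMatrix _)
  · simp [ComplexBlock.neg]
  · have := b.hm
    rw [hw, if_pos ⟨rfl, by simp only; omega⟩]
    exact one_pos
  · rw [hw, if_neg]
    rintro ⟨h1, h2⟩
    obtain ⟨l, m, hm⟩ := b
    obtain ⟨l', m', hm'⟩ := c
    simp only at h1 h2
    apply h
    rw [ComplexBlock.mk.injEq]
    exact ⟨h1, by omega⟩
  · rw [hw, hw]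
    simp only [ComplexBlock.neg, neg_eq_iff_eq_neg]
  · have := b.hm
    rw [hw, if_pos ⟨rfl, by simp only; omega⟩]
    exact one_dvd _

theorem complexBlock_isPair_iff (b c : ComplexBlock) :
    b.IsPair c ↔ b.neg ≠ b ∧ c = b.neg := by
  obtain ⟨l, m, hm⟩ := b
  obtain ⟨l', m', hm'⟩ := c
  simp [ComplexBlock.IsPair, ComplexBlock.neg, neg_eq_self]

theorem complexBlock_isSingleton_iff (b : ComplexBlock) : b.IsSingleton ↔ b.neg = b := by
  obtain ⟨l, m, hm⟩ := b
  simp [ComplexBlock.IsSingleton, ComplexBlock.neg, neg_eq_self]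

/-! ### The real case -/

/-- The real numbers as complex `1 × 1` matrices. -/
noncomputable def realToMatrix : ℝ →ₐ[ℝ] Matrix (Fin 1) (Fin 1) ℂ :=
  Algebra.ofId ℝ (Matrix (Fin 1) (Fin 1) ℂ)

theorem realToMatrix_apply (r : ℝ) (a b : Fin 1) : realToMatrix r a b = r := by
  rw [Subsingleton.elim a b]
  simp [realToMatrix, Algebra.ofId_apply, Matrix.algebraMap_matrix_apply]

theorem isComplexification_realToMatrix : IsComplexification realToMatrix where
  exists_eq A := by
    refine ⟨(A 0 0).re, (A 0 0).im, ?_⟩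
    ext a b
    rw [Subsingleton.elim a 0, Subsingleton.elim b 0]
    simp only [Matrix.add_apply, Matrix.smul_apply, realToMatrix_apply, smul_eq_mul]
    rw [mul_comm, Complex.re_add_im]
  eq_zero p q h := by
    have := congrFun (congrFun h 0) 0
    simp only [Matrix.add_apply, Matrix.smul_apply, realToMatrix_apply, smul_eq_mul,
      Matrix.zero_apply] at this
    exact ⟨by simpa using congrArg Complex.re this, by simpa using congrArg Complex.im this⟩

theorem similar_complexify_realToMatrix {ι : Type*} [Fintype ι] [DecidableEq ι]
    (A : Matrix ι ι ℝ) : Similar (complexify realToMatrix A) (A.map Complex.ofReal) := by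
  have : complexify realToMatrix A = (A.map Complex.ofReal).submatrix
      (Equiv.prodUnique ι (Fin 1)) (Equiv.prodUnique ι (Fin 1)) := by
    ext ⟨i, a⟩ ⟨j, b⟩
    simp [complexify, realToMatrix_apply]
  rw [this]
  exact similar_submatrix _ _

theorem blockCount_complexify_realToMatrix_conj {ι : Type*} [Fintype ι] [DecidableEq ι]
    (A : Matrix ι ι ℝ) (z : ℂ) (m : ℕ) :
    blockCount (complexify realToMatrix A) z m =
      blockCount (complexify realToMatrix A) (starRingEnd ℂ z) m := by
  rw [← blockCount_map_conj]
  congr 1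
  ext ⟨i, a⟩ ⟨j, b⟩
  simp [complexify, realToMatrix_apply]

theorem ite_conj_jordanBlock_apply (z : ℂ) {m : ℕ} (b : Fin 2) (i j : Fin m) :
    jordanBlock (if b = 0 then z else starRingEnd ℂ z) m i j =
      if b = 0 then jordanBlock z m i j else starRingEnd ℂ (jordanBlock z m i j) := by
  by_cases hb : b = 0
  · simp only [hb, if_true]
  · simp only [hb, if_false, jordanBlock, of_apply]
    split_ifs <;> simp

theorem blockCount_realJordanBlock (z w : ℂ) (l t : ℕ) :
    blockCount (complexify realToMatrix (realJordanBlock z l)) w t =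
      (if z = w ∧ l = t + 1 then 1 else 0) +
        if starRingEnd ℂ z = w ∧ l = t + 1 then 1 else 0 := by
  let M : Matrix (Fin l × Fin 2) (Fin l × Fin 2) ℂ :=
    of fun p q => (psi (jordanBlock z l p.1 q.1) p.2 q.2 : ℂ)
  let N : Matrix (Fin l × Fin 2) (Fin l × Fin 2) ℂ := of fun p q =>
    if p.2 = q.2 then jordanBlock (if p.2 = 0 then z else starRingEnd ℂ z) l p.1 q.1 else 0
  have h1 : Similar ((realJordanBlock z l).map Complex.ofReal) M :=
    similar_submatrix M finProdFinEquiv.symm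
  -- The columns `(1, i)` and `(1, -i)` are eigenvectors of every `psi x`, with eigenvalues `x` and
  -- its conjugate; `1 ⊗ U` therefore separates the two complex Jordan blocks.
  let U : Matrix (Fin 2) (Fin 2) ℂ := !![1, 1; Complex.I, -Complex.I]
  let V : Matrix (Fin 2) (Fin 2) ℂ := !![1 / 2, -Complex.I / 2; 1 / 2, Complex.I / 2]
  have hUV : U * V = 1 := by
    ext a b
    fin_cases a <;> fin_cases b <;> simp [U, V, Complex.ext_iff] <;> norm_num
  have hVU : V * U = 1 := mul_eq_one_comm.1 hUV
  have hU : ∀ (x : ℂ) (a b : Fin 2), ∑ c, (psi x a c : ℂ) * U c b =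
      U a b * if b = 0 then x else starRingEnd ℂ x := by
    intro x a b
    rw [Fin.sum_univ_two]
    fin_cases a <;> fin_cases b <;> simp [U, psi, Complex.ext_iff]
  let K : Matrix (Fin l × Fin 2) (Fin l × Fin 2) ℂ := kroneckerMap (· * ·) 1 U
  have h2 : Similar M N := by
    refine ⟨K, kroneckerMap (· * ·) 1 V, ?_, ?_, ?_⟩
    · rw [← mul_kronecker_mul, hUV, Matrix.one_mul, one_kronecker_one]
    · rw [← mul_kronecker_mul, hVU, Matrix.one_mul, one_kronecker_one]
    · ext ⟨i, a⟩ ⟨j, b⟩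
      have hl : (M * K) (i, a) (j, b) =
          ∑ c, (psi (jordanBlock z l i j) a c : ℂ) * U c b := by
        simp only [Matrix.mul_apply, Fintype.sum_prod_type, kroneckerMap_apply, Matrix.one_apply,
          M, K, of_apply]
        rw [Finset.sum_eq_single j]
        · simp
        · intro x _ hx
          simp [hx]
        · simp
      have hr : (K * N) (i, a) (j, b) =
          U a b * jordanBlock (if b = 0 then z else starRingEnd ℂ z) l i j := by
        simp only [Matrix.mul_apply, Fintype.sum_prod_type, kroneckerMap_apply, Matrix.one_apply,
          N, K, of_apply]
        rw [Finset.sum_eq_single i, Finset.sum_eq_single b]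
        · simp
        · intro x _ hx
          simp [hx]
        · simp
        · intro x _ hx
          simp [hx.symm]
        · simp
      rw [hl, hr, ite_conj_jordanBlock_apply, hU]
  rw [((similar_complexify_realToMatrix _).trans (h1.trans h2)).blockCount_eq]
  exact blockCount_of_conj_pair (fun i a j b => rfl) w t

theorem blockCount_complexify_ofReal_jordanBlock (a : ℝ) (w : ℂ) (m t : ℕ) :
    blockCount (complexify realToMatrix (jordanBlock a m)) w t =
      if (a : ℂ) = w ∧ m = t + 1 then 1 else 0 := by
  have : (jordanBlock a m).map Complex.ofReal = jordanBlock (a : ℂ) m := by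
    ext i j
    simp only [jordanBlock, map_apply, of_apply]
    split_ifs <;> simp
  rw [(similar_complexify_realToMatrix _).blockCount_eq, this, blockCount_jordanBlock]

/-- The block `J(-λ, m)` or `J_ℝ(-μ ± iν, 2l)`. -/
def RealBlock.neg : RealBlock → RealBlock
  | .ofReal lam m hm => .ofReal (-lam) m hm
  | .ofComplex mu nu l hnu hl => .ofComplex (-mu) nu l hnu hl

/-- The eigenvalue with non-negative imaginary part, and the size minus one, of a complex Jordan
block contained in a real block. -/
def RealBlock.key : RealBlock → ℂ × ℕ
  | .ofReal lam m _ => (lam, m - 1)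
  | .ofComplex mu nu l _ _ => (⟨mu, nu⟩, l - 1)

theorem RealBlock.blockCount_ofReal (lam : ℝ) (m : ℕ) (hm : 0 < m) (w : ℂ) (t : ℕ) :
    blockCount (complexify realToMatrix (RealBlock.ofReal lam m hm).toMatrix) w t =
      if (lam : ℂ) = w ∧ m = t + 1 then 1 else 0 :=
  blockCount_complexify_ofReal_jordanBlock lam w m t

theorem RealBlock.blockCount_ofComplex (mu nu : ℝ) (l : ℕ) (hnu : 0 < nu) (hl : 0 < l) (w : ℂ)
    (t : ℕ) :
    blockCount (complexify realToMatrix (RealBlock.ofComplex mu nu l hnu hl).toMatrix) w t =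
      (if (⟨mu, nu⟩ : ℂ) = w ∧ l = t + 1 then 1 else 0) +
        if starRingEnd ℂ ⟨mu, nu⟩ = w ∧ l = t + 1 then 1 else 0 :=
  blockCount_realJordanBlock ⟨mu, nu⟩ w l t

-- A key has eigenvalue of nonnegative imaginary part, so the second eigenvalue `μ - iν` of a
-- complex pair never meets one.
open Classical in
theorem RealBlock.blockCount_key (b c : RealBlock) :
    blockCount (complexify realToMatrix b.toMatrix) c.key.1 c.key.2 = if b = c then 1 else 0 := by
  rcases b with ⟨lam, m, hm⟩ | ⟨mu, nu, l, hnu, hl⟩ <;>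
    rcases c with ⟨lam', m', hm'⟩ | ⟨mu', nu', l', hnu', hl'⟩
  · have : m = m' - 1 + 1 ↔ m = m' := by omega
    simp [blockCount_ofReal, key, this]
  · rw [blockCount_ofReal, key]
    simp [Complex.ext_iff, hnu'.ne]
  · rw [blockCount_ofComplex, key]
    simp [Complex.ext_iff, hnu.ne']
  · have h1 : l = l' - 1 + 1 ↔ l = l' := by omega
    have h2 : -nu ≠ nu' := by linarith
    rw [blockCount_ofComplex, key]
    simp only [h1]
    simp [Complex.ext_iff, h2, and_assoc]

theorem isBlockSystem_realBlock :
    IsBlockSystem realToMatrix RealBlock.size RealBlock.toMatrix RealBlock.neg RealBlock.key := by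
  classical
  refine ⟨one_pos, isComplexification_realToMatrix.similar_of_complexify, fun b => ?_, fun b => ?_,
    fun {b c} h => ?_, fun b z t => ?_, fun z m => ?_, fun b n X => ?_⟩
  · cases b <;> simp [RealBlock.neg]
  · simp [RealBlock.blockCount_key]
  · rw [RealBlock.blockCount_key, if_neg h]
  · rcases b with ⟨lam, m, hm⟩ | ⟨mu, nu, l, hnu, hl⟩
    · rw [RealBlock.neg, RealBlock.blockCount_ofReal, RealBlock.blockCount_ofReal]
      simp only [Complex.ofReal_neg, neg_eq_iff_eq_neg]
    -- `-(μ + iν)` is the conjugate of `-μ + iν`: negation swaps the two conjugate summands.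
    · rw [RealBlock.neg, RealBlock.blockCount_ofComplex, RealBlock.blockCount_ofComplex, add_comm]
      simp [Complex.ext_iff, neg_eq_iff_eq_neg]
  · rcases lt_trichotomy z.im 0 with hz | hz | hz
    · refine ⟨.ofComplex z.re (-z.im) (m + 1) (by linarith) m.succ_pos, fun n X => ?_⟩
      rw [blockCount_complexify_realToMatrix_conj]
      rfl
    · refine ⟨.ofReal z.re (m + 1) m.succ_pos, fun n X => ?_⟩
      have : z = (z.re : ℂ) := Complex.ext rfl (by simp [hz])
      rw [this]
      rfl
    · exact ⟨.ofComplex z.re z.im (m + 1) hz m.succ_pos, fun n X => rfl⟩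
  · simp [RealBlock.blockCount_key]

theorem realBlock_isPair_iff (b c : RealBlock) : b.IsPair c ↔ b.neg ≠ b ∧ c = b.neg := by
  rcases b with ⟨lam, m, hm⟩ | ⟨mu, nu, l, hnu, hl⟩ <;>
    rcases c with ⟨lam', m', hm'⟩ | ⟨mu', nu', l', hnu', hl'⟩ <;>
    simp [RealBlock.IsPair, RealBlock.neg, neg_eq_self]

theorem realBlock_isSingleton_iff (b : RealBlock) : b.IsSingleton ↔ b.neg = b := by
  cases b <;> simp [RealBlock.IsSingleton, RealBlock.neg, neg_eq_self]

/-! ### The quaternionic case -/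

/-- The quaternions as complex `2 × 2` matrices. -/
noncomputable def quaternionToMatrix : ℍ[ℝ] →ₐ[ℝ] Matrix (Fin 2) (Fin 2) ℂ where
  toFun q := !![⟨q.re, q.imI⟩, ⟨q.imJ, q.imK⟩; ⟨-q.imJ, q.imK⟩, ⟨q.re, -q.imI⟩]
  map_one' := by
    ext a b
    fin_cases a <;> fin_cases b <;> simp [Complex.ext_iff]
  map_mul' p q := by
    ext a b
    fin_cases a <;> fin_cases b <;> simp [Complex.ext_iff] <;> constructor <;> ring
  map_zero' := by
    ext a b
    fin_cases a <;> fin_cases b <;> simp [Complex.ext_iff]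
  map_add' p q := by
    ext a b
    fin_cases a <;> fin_cases b <;> simp [Complex.ext_iff, add_comm]
  commutes' r := by
    ext a b
    fin_cases a <;> fin_cases b <;>
      simp [Complex.ext_iff, Matrix.algebraMap_matrix_apply]

theorem quaternionToMatrix_apply (q : ℍ[ℝ]) : quaternionToMatrix q =
    !![⟨q.re, q.imI⟩, ⟨q.imJ, q.imK⟩; ⟨-q.imJ, q.imK⟩, ⟨q.re, -q.imI⟩] := rfl

theorem exists_quaternion (a b c d : ℝ) :
    ∃ q : ℍ[ℝ], q.re = a ∧ q.imI = b ∧ q.imJ = c ∧ q.imK = d :=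
  ⟨⟨a, b, c, d⟩, rfl, rfl, rfl, rfl⟩

theorem isComplexification_quaternionToMatrix : IsComplexification quaternionToMatrix where
  exists_eq A := by
    -- The image of `ℍ` is fixed by the antilinear involution `τ A = U * conj A * U⁻¹` with `U =
    -- !![0, 1; -1, 0]`; `p` corresponds to `(A + τ A) / 2` and `q` to `(A - τ A) / (2i)`.
    obtain ⟨p, hp⟩ := exists_quaternion (((A 0 0).re + (A 1 1).re) / 2)
      (((A 0 0).im - (A 1 1).im) / 2) (((A 0 1).re - (A 1 0).re) / 2)
      (((A 0 1).im + (A 1 0).im) / 2)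
    obtain ⟨q, hq⟩ := exists_quaternion (((A 0 0).im + (A 1 1).im) / 2)
      (((A 1 1).re - (A 0 0).re) / 2) (((A 0 1).im - (A 1 0).im) / 2)
      (-((A 0 1).re + (A 1 0).re) / 2)
    refine ⟨p, q, ?_⟩
    ext a b
    fin_cases a <;> fin_cases b <;>
      simp [quaternionToMatrix_apply, Complex.ext_iff, hp, hq] <;> constructor <;> ring
  eq_zero p q h := by
    have h00 := congrFun (congrFun h 0) 0
    have h01 := congrFun (congrFun h 0) 1
    have h10 := congrFun (congrFun h 1) 0
    have h11 := congrFun (congrFun h 1) 1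
    simp [quaternionToMatrix_apply, Complex.ext_iff] at h00 h01 h10 h11
    constructor <;> ext <;> simp <;> linarith

theorem blockCount_quaternion_jordanBlock (z w : ℂ) (m t : ℕ) :
    blockCount (complexify quaternionToMatrix (jordanBlock (z : ℍ[ℝ]) m)) w t =
      (if z = w ∧ m = t + 1 then 1 else 0) +
        if starRingEnd ℂ z = w ∧ m = t + 1 then 1 else 0 := by
  refine blockCount_of_conj_pair (fun i a j b => ?_) w t
  have hz : ∀ a b, quaternionToMatrix (z : ℍ[ℝ]) a b =
      if a = b then (if a = 0 then z else starRingEnd ℂ z) else 0 := by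
    intro a b
    fin_cases a <;> fin_cases b <;> simp [quaternionToMatrix_apply, Complex.ext_iff]
  simp only [complexify, jordanBlock, of_apply]
  by_cases h1 : i = j
  · simp only [h1, if_true, hz]
  · simp only [h1, if_false]
    split_ifs with h2 h3 h3 <;> simp [h3]

/-- Conjugation by the image `U` of the quaternion `j` turns the complexification into its entrywise
complex conjugate. -/
theorem blockCount_complexify_quaternionToMatrix_conj {ι : Type*} [Fintype ι] [DecidableEq ι]
    (A : Matrix ι ι ℍ[ℝ]) (z : ℂ) (m : ℕ) :
    blockCount (complexify quaternionToMatrix A) z m =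
      blockCount (complexify quaternionToMatrix A) (starRingEnd ℂ z) m := by
  rw [← blockCount_map_conj]
  refine Similar.blockCount_eq ?_ z m
  let U : Matrix (Fin 2) (Fin 2) ℂ := !![0, 1; -1, 0]
  have hU : U * -U = 1 := by
    ext a b
    fin_cases a <;> fin_cases b <;> simp [U]
  have hU' : -U * U = 1 := mul_eq_one_comm.1 hU
  have hq : ∀ q : ℍ[ℝ], quaternionToMatrix q * U =
      U * (quaternionToMatrix q).map (starRingEnd ℂ) := by
    intro q
    ext a b
    fin_cases a <;> fin_cases b <;>
      simp [U, quaternionToMatrix_apply, Complex.ext_iff, Matrix.mul_apply]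
  let K : Matrix (ι × Fin 2) (ι × Fin 2) ℂ := kroneckerMap (· * ·) 1 U
  refine ⟨K, kroneckerMap (· * ·) 1 (-U), ?_, ?_, ?_⟩
  · rw [← mul_kronecker_mul, hU, Matrix.one_mul, one_kronecker_one]
  · rw [← mul_kronecker_mul, hU', Matrix.one_mul, one_kronecker_one]
  · ext ⟨i, a⟩ ⟨j, b⟩
    have hl : (complexify quaternionToMatrix A * K) (i, a) (j, b) =
        (quaternionToMatrix (A i j) * U) a b := by
      simp only [Matrix.mul_apply, Fintype.sum_prod_type, kroneckerMap_apply, Matrix.one_apply,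
        complexify, K, of_apply]
      rw [Finset.sum_eq_single j]
      · simp
      · intro x _ hx
        simp [hx]
      · simp
    have hr : (K * (complexify quaternionToMatrix A).map (starRingEnd ℂ)) (i, a) (j, b) =
        (U * (quaternionToMatrix (A i j)).map (starRingEnd ℂ)) a b := by
      simp only [Matrix.mul_apply, Fintype.sum_prod_type, kroneckerMap_apply, Matrix.one_apply,
        complexify, K, of_apply, map_apply]
      rw [Finset.sum_eq_single i]
      · simp
      · intro x _ hx
        simp [hx.symm]
      · simp
    rw [hl, hr, hq]

/-- Quaternionic row vectors as complex row vectors of twice the length. -/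
noncomputable def quaternionRowEquiv (ι : Type*) : (ι → ℍ[ℝ]) ≃ₗ[ℝ] (ι × Fin 2 → ℂ) where
  toFun v p := quaternionToMatrix (v p.1) 0 p.2
  invFun u i := ⟨(u (i, 0)).re, (u (i, 0)).im, (u (i, 1)).re, (u (i, 1)).im⟩
  map_add' v w := by
    ext p
    simp
  map_smul' r v := by
    ext p
    simp
  left_inv v := by
    ext i <;> simp [quaternionToMatrix_apply]
  right_inv u := by
    ext ⟨i, a⟩
    fin_cases a
    · exact Complex.eta (u (i, 0))
    · exact Complex.eta (u (i, 1))

theorem quaternionRowEquiv_apply {ι : Type*} (v : ι → ℍ[ℝ]) (p : ι × Fin 2) :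
    quaternionRowEquiv ι v p = quaternionToMatrix (v p.1) 0 p.2 := rfl

/-- The first row of a product is the first row of the left factor times the right factor, and the
first row of its matrix determines a quaternion. -/
theorem quaternionRowEquiv_vecMul {ι : Type*} [Fintype ι] (A : Matrix ι ι ℍ[ℝ])
    (v : ι → ℍ[ℝ]) : quaternionRowEquiv ι (v ᵥ* A) =
      quaternionRowEquiv ι v ᵥ* complexify quaternionToMatrix A := by
  ext ⟨j, b⟩
  simp only [quaternionRowEquiv_apply, vecMul, dotProduct, map_sum, map_mul, Matrix.sum_apply, Matrix.mul_apply, Fintype.sum_prod_type,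
    complexify, of_apply]

/-- The row space of `A` is a left `ℍ`-space, identified over `ℝ` with the complex row space of the
complexification. Its real dimension is `4 dim_ℍ` and also twice the complex rank. -/
theorem even_rank_complexify_quaternionToMatrix {ι : Type*} [Fintype ι] [DecidableEq ι]
    (A : Matrix ι ι ℍ[ℝ]) : Even (complexify quaternionToMatrix A).rank := by
  set W := LinearMap.range (vecMulLinear A) with hW
  set W' := LinearMap.range (vecMulLinear (complexify quaternionToMatrix A)) with hW'
  have h1 : (complexify quaternionToMatrix A).rank = Module.finrank ℂ W' := by
    rw [← rank_transpose, Matrix.rank, mulVecLin_transpose]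
  have h2 : (W.restrictScalars ℝ).map (quaternionRowEquiv ι).toLinearMap =
      W'.restrictScalars ℝ := by
    ext u
    simp only [Submodule.mem_map, Submodule.restrictScalars_mem, hW, hW', LinearMap.mem_range,
      vecMulLinear_apply]
    constructor
    · rintro ⟨_, ⟨v, rfl⟩, rfl⟩
      exact ⟨_, (quaternionRowEquiv_vecMul A v).symm⟩
    · rintro ⟨u, rfl⟩
      refine ⟨_, ⟨(quaternionRowEquiv ι).symm u, rfl⟩, ?_⟩
      rw [LinearEquiv.coe_coe, quaternionRowEquiv_vecMul, LinearEquiv.apply_symm_apply]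
  have h3 : Module.finrank ℝ (W.restrictScalars ℝ) = Module.finrank ℝ (W'.restrictScalars ℝ) := by
    rw [← h2]
    exact ((quaternionRowEquiv ι).finrank_map_eq _).symm
  have h4 : Module.finrank ℝ W = 4 * Module.finrank ℍ[ℝ] W := by
    rw [← Module.finrank_mul_finrank ℝ ℍ[ℝ] W, Quaternion.finrank_eq_four]
  have h5 : Module.finrank ℝ W' = 2 * Module.finrank ℂ W' := by
    rw [← Module.finrank_mul_finrank ℝ ℂ W', Complex.finrank_real_complex]
  have h6 : Module.finrank ℝ W = Module.finrank ℝ W' := h3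
  rw [h1]
  exact ⟨Module.finrank ℍ[ℝ] W, by omega⟩

/-- For real `z` the powers of `M - z` are themselves complexifications of quaternionic matrices, so
their ranks are even. -/
theorem even_blockCount_complexify_quaternionToMatrix {ι : Type*} [Fintype ι] [DecidableEq ι]
    (A : Matrix ι ι ℍ[ℝ]) (z : ℂ) (hz : z.im = 0) (m : ℕ) :
    2 ∣ blockCount (complexify quaternionToMatrix A) z m := by
  have h : ∀ t, Even (rankPow (complexify quaternionToMatrix A) z t) := by
    intro t
    have hz' : z = (z.re : ℂ) := Complex.ext rfl (by simp [hz])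
    rw [rankPow, hz', ← complexify_one (ι := ι) quaternionToMatrix, ← complexify_smul,
      ← complexify_sub, ← complexify_pow]
    exact even_rank_complexify_quaternionToMatrix _
  have h1 := (Int.even_coe_nat _).2 (h m)
  have h2 := (Int.even_coe_nat _).2 (h (m + 2))
  exact dvd_sub (dvd_add h1.two_dvd h2.two_dvd) (dvd_mul_right _ _)

/-- The block `J(-conj λ, m)`. -/
def QuaternionBlock.neg (b : QuaternionBlock) : QuaternionBlock :=
  ⟨-(starRingEnd ℂ b.lam), b.m, by simpa using b.hlam, b.hm⟩

theorem isBlockSystem_quaternionBlock :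
    IsBlockSystem quaternionToMatrix QuaternionBlock.m
      (fun b => jordanBlock (b.lam : ℍ[ℝ]) b.m)
      QuaternionBlock.neg (fun b => (b.lam, b.m - 1)) := by
  refine ⟨two_pos, isComplexification_quaternionToMatrix.similar_of_complexify, fun b => ?_,
    fun b => ?_, fun {b c} h => ?_, fun b z t => ?_, fun z m => ?_, fun b n X => ?_⟩
  · simp [QuaternionBlock.neg]
  · have := b.hm
    rw [blockCount_quaternion_jordanBlock, if_pos ⟨rfl, by simp only; omega⟩]
    split_ifs <;> norm_num
  · obtain ⟨z, m, hz, hm⟩ := b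
    obtain ⟨z', m', hz', hm'⟩ := c
    have hne : ¬ (z = z' ∧ m = m' - 1 + 1) := by
      rintro ⟨h1, h2⟩
      apply h
      rw [QuaternionBlock.mk.injEq]
      exact ⟨h1, by omega⟩
    rw [blockCount_quaternion_jordanBlock, if_neg hne, if_neg, add_zero]
    rintro ⟨h1, h2⟩
    refine hne ⟨?_, h2⟩
    -- If the conjugate of `z` is `z'` and both imaginary parts are nonnegative, both vanish and `z
    -- = z'`.
    simp only [Complex.ext_iff, Complex.conj_re, Complex.conj_im] at h1 ⊢
    exact ⟨h1.1, by linarith⟩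
  · rw [blockCount_quaternion_jordanBlock, blockCount_quaternion_jordanBlock, add_comm]
    simp [QuaternionBlock.neg, neg_eq_iff_eq_neg]
  · rcases le_total 0 z.im with hz | hz
    · exact ⟨⟨z, m + 1, hz, m.succ_pos⟩, fun n X => rfl⟩
    · refine ⟨⟨starRingEnd ℂ z, m + 1, by simpa using hz, m.succ_pos⟩, fun n X => ?_⟩
      exact blockCount_complexify_quaternionToMatrix_conj X z m
  · have := b.hm
    have hm : b.m = b.m - 1 + 1 := by omega
    simp only [blockCount_quaternion_jordanBlock, ← hm, and_true, if_true]
    -- The block's own count is `2` for a real eigenvalue, where evenness is needed, and `1`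
    -- otherwise.
    split_ifs with h
    · exact even_blockCount_complexify_quaternionToMatrix X _ (Complex.conj_eq_iff_im.1 h) _
    · simp

theorem quaternionBlock_isPair_iff (b c : QuaternionBlock) :
    b.IsPair c ↔ b.neg ≠ b ∧ c = b.neg := by
  obtain ⟨l, m, hl, hm⟩ := b
  obtain ⟨l', m', hl', hm'⟩ := c
  simp [QuaternionBlock.IsPair, QuaternionBlock.neg, neg_eq_self, Complex.ext_iff]

theorem quaternionBlock_isSingleton_iff (b : QuaternionBlock) :
    b.IsSingleton ↔ b.neg = b := by
  obtain ⟨l, m, hl, hm⟩ := b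
  simp [QuaternionBlock.IsSingleton, QuaternionBlock.neg, neg_eq_self, Complex.ext_iff]

end AdjointReality

theorem mainTheorem1 (n : ℕ) :
    (∀ X : Matrix (Fin n) (Fin n) ℝ,
      (∃ (k : ℕ) (b : Fin k → AdjointReality.RealBlock), AdjointReality.IsRealJordanForm X b) ∧
      ∀ (k : ℕ) (b : Fin k → AdjointReality.RealBlock), AdjointReality.IsRealJordanForm X b →
        (AdjointReality.IsAdReal X ↔
          AdjointReality.CanBePartitioned b AdjointReality.RealBlock.IsPair
            AdjointReality.RealBlock.IsSingleton)) ∧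
    (∀ X : Matrix (Fin n) (Fin n) ℂ,
      (∃ (k : ℕ) (b : Fin k → AdjointReality.ComplexBlock),
        AdjointReality.IsComplexJordanForm X b) ∧
      ∀ (k : ℕ) (b : Fin k → AdjointReality.ComplexBlock),
        AdjointReality.IsComplexJordanForm X b →
        (AdjointReality.IsAdReal X ↔
          AdjointReality.CanBePartitioned b AdjointReality.ComplexBlock.IsPair
            AdjointReality.ComplexBlock.IsSingleton)) ∧
    (∀ X : Matrix (Fin n) (Fin n) ℍ[ℝ],
      (∃ (k : ℕ) (b : Fin k → AdjointReality.QuaternionBlock),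
        AdjointReality.IsQuaternionJordanForm X b) ∧
      ∀ (k : ℕ) (b : Fin k → AdjointReality.QuaternionBlock),
        AdjointReality.IsQuaternionJordanForm X b →
        (AdjointReality.IsAdReal X ↔
          AdjointReality.CanBePartitioned b AdjointReality.QuaternionBlock.IsPair
            AdjointReality.QuaternionBlock.IsSingleton)) := by
  refine ⟨fun X => ⟨?_, fun k b hX => ?_⟩, fun X => ⟨?_, fun k b hX => ?_⟩,
    fun X => ⟨?_, fun k b hX => ?_⟩⟩
  · exact AdjointReality.isBlockSystem_realBlock.exists_isConjToDirectSum X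
  · rw [AdjointReality.isBlockSystem_realBlock.isAdReal_iff hX]
    simp only [AdjointReality.CanBePartitioned, AdjointReality.realBlock_isPair_iff,
      AdjointReality.realBlock_isSingleton_iff]
  · exact AdjointReality.isBlockSystem_complexBlock.exists_isConjToDirectSum X
  · rw [AdjointReality.isBlockSystem_complexBlock.isAdReal_iff hX]
    simp only [AdjointReality.CanBePartitioned, AdjointReality.complexBlock_isPair_iff,
      AdjointReality.complexBlock_isSingleton_iff]
  · exact AdjointReality.isBlockSystem_quaternionBlock.exists_isConjToDirectSum X
  · rw [AdjointReality.isBlockSystem_quaternionBlock.isAdReal_iff hX]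
    simp only [AdjointReality.CanBePartitioned, AdjointReality.quaternionBlock_isPair_iff,
      AdjointReality.quaternionBlock_isSingleton_iff]
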